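/- Let $M$ be a compact (Hausdorff, not necessarily connected) complex manifold of complex dimension $n$, let $1<p\le n-1$, and put $k=n-p$. Write $\mathcal A^{r}(M,\mathbb C)$ and $\mathcal A^{a,b}(M)$ for the smooth complex-valued $r$-forms and the smooth forms of bidegree $(a,b)$, and $d=\partial+\bar\partial$. A $(k,0)$-form $\beta$ at a point is called simple if $\beta=\beta^1\wedge\dots\wedge\beta^k$ for some $(1,0)$-forms $\beta^i$ at that point; a form $\xi \in\mathcal A^{k,0}(M)$ is called simple if it is simple at every point. Let $\sigma_m=i^{m^2}2^{-m}$. A form of bidegree $(n,n)$ at a point is strictly positive if it is a positive real multiple of $\sigma_n\,\varphi^1\wedge\dots\wedge\varphi^n\wedge\bar\varphi^1\wedge\dots\wedge\bar\varphi^n$ for a basis $\varphi^1,\dots,\varphi^n$ of the $(1,0)$-forms at that point (this does not depend on the basis). Let $\Omega$ be a $p$-Kähler structure on $M$, that is, a real form $\Omega\in\mathcal A^{p,p}(M)$ with $d\Omega=0$ which is transverse: at every point, $\sigma_{k}\,\Omega\wedge\beta\wedge\bar\beta$ is strictly positive for every simple $(k,0)$-form $\beta\ne0$. Suppose that the class of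 $\Omega$ vanishes in at least one of the de Rham, Aeppli, Bott–Chern, $\partial$- or $\bar\partial$-cohomologies, i.e. that at least one of the following holds: - (dR) $\Omega=d\eta$ for some $\eta\in\mathcal A^{2p-1}(M,\mathbb C)$; - (A) $\Omega=\partial\lambda+\bar\partial\mu$ for some $\lambda\in\mathcal A^{p-1,p}(M)$, $\mu\in\mathcal A^{p,p-1}(M)$; - (BC) $\Omega=\partial\bar\partial\eta$ for some $\eta\in\mathcal A^{p-1,p-1}(M)$; - ($\partial$) $\Omega=\partial\lambda$ for some $\lambda\in\mathcal A^{p-1,p}(M)$; - ($\bar\partial$) $\Omega=\bar\partial\mu$ for some $\mu\in\mathcal A^{p,p-1}(M)$. Then there is no simple form $\xi\in\mathcal A^{k,0}(M)$, not identically zero, such that $\partial\xi=\bar\partial\xi=0$. (In particular, if $M\neq\emptyset$, there is no nowhere-vanishing one.) -/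

import Mathlib

open scoped Manifold ContDiff

noncomputable section

/-! ### Linear algebra of complex-valued forms on a complex vector space `V`

`V [⋀^Fin r]→L[ℝ] ℂ` is the space of complex-valued real-multilinear alternating `r`-forms on `V`,
that is, the `r`-th exterior power of the dual of `V ⊗ ℂ`. -/

namespace PKahler

section Pointwise

variable {V : Type*} [NormedAddCommGroup V] [NormedSpace ℂ V]

/-- Exterior product of complex-valued forms, normalised by summing over shuffles, so that
`(φ ∧ ψ) (u, v) = φ u * ψ v - φ v * ψ u` for 1-forms. -/
def wedge {r s : ℕ} (α : V [⋀^Fin r]→L[ℝ] ℂ) (β : V [⋀^Fin s]→L[ℝ] ℂ) :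
    V [⋀^Fin (r + s)]→L[ℝ] ℂ :=
  { ((LinearMap.mul' ℝ ℂ).compAlternatingMap
      (α.toAlternatingMap.domCoprod β.toAlternatingMap)).domDomCongr finSumFinEquiv with
    cont := by
      have key : ∀ σ : Equiv.Perm.ModSumCongr (Fin r) (Fin s),
          Continuous fun v : Fin r ⊕ Fin s → V => LinearMap.mul' ℝ ℂ
            (AlternatingMap.domCoprod.summand α.toAlternatingMap β.toAlternatingMap σ v) := by
        intro σ
        induction σ using Quotient.inductionOn' with
        | h σ =>
          have h : Continuous fun v : Fin r ⊕ Fin s → V =>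
              Equiv.Perm.sign σ • (α (fun i => v (σ (Sum.inl i))) *
                β (fun i => v (σ (Sum.inr i)))) := by
            refine Continuous.const_smul ?_ _
            exact (α.cont.comp (by fun_prop)).mul (β.cont.comp (by fun_prop))
          refine h.congr fun v => ?_
          rw [AlternatingMap.domCoprod.summand_mk'']
          rw [Units.smul_def, Units.smul_def, smul_apply, map_zsmul]
          rfl
      have h2 : Continuous fun v : Fin r ⊕ Fin s → V => LinearMap.mul' ℝ ℂ
          (α.toAlternatingMap.domCoprod β.toAlternatingMap v) := by
        simp only [AlternatingMap.domCoprod_apply, sum_apply, map_sum]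
        exact continuous_finsetSum _ fun σ _ => key σ
      exact h2.comp (f := fun v : Fin (r + s) → V => fun i => v (finSumFinEquiv i))
        (by fun_prop) }

/-- The complex conjugate of a form. -/
def conj {r : ℕ} (α : V [⋀^Fin r]→L[ℝ] ℂ) : V [⋀^Fin r]→L[ℝ] ℂ :=
  (Complex.conjCLE : ℂ →L[ℝ] ℂ).compContinuousAlternatingMap α

/-- Transport of a form along an equality of degrees. -/
def castDeg {r s : ℕ} (h : r = s) (α : V [⋀^Fin r]→L[ℝ] ℂ) : V [⋀^Fin s]→L[ℝ] ℂ :=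
  { α.toAlternatingMap.domDomCongr (finCongr h) with
    cont := α.cont.comp (f := fun v : Fin s → V => fun i => v (finCongr h i)) (by fun_prop) }

/-- The form `f₁ ∧ ⋯ ∧ fₖ` for `(1,0)`-forms `f₁, …, fₖ`, i.e. complex-linear functionals:
its value at `(v₁, …, vₖ)` is `det (fᵢ vⱼ)`. -/
def wedgeFun {k : ℕ} (f : Fin k → (V →L[ℂ] ℂ)) : V [⋀^Fin k]→L[ℝ] ℂ :=
  ContinuousAlternatingMap.restrictScalars ℝ
    ({ (Matrix.detRowAlternating (n := Fin k) (R := ℂ)).compLinearMap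
        (ContinuousLinearMap.pi f).toLinearMap with
      cont := by
        have h : Continuous fun v : Fin k → V => Matrix.det (Matrix.of fun j i => f i (v j)) := by
          refine Continuous.matrix_det ?_
          exact continuous_matrix fun i j =>
            (f j).continuous.comp (continuous_apply i)
        exact h } : V [⋀^Fin k]→L[ℂ] ℂ)

theorem wedgeFun_apply {k : ℕ} (f : Fin k → (V →L[ℂ] ℂ)) (v : Fin k → V) :
    wedgeFun f v = Matrix.det (Matrix.of fun i j => f i (v j)) := by
  rw [← Matrix.det_transpose]
  rfl

/-- A `(k,0)`-form is simple if it is a product `f₁ ∧ ⋯ ∧ fₖ` of `(1,0)`-forms. -/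
def IsSimple {k : ℕ} (β : V [⋀^Fin k]→L[ℝ] ℂ) : Prop :=
  ∃ f : Fin k → (V →L[ℂ] ℂ), β = wedgeFun f

variable (V) in
/-- The forms of bidegree `(p,q)`: the complex span of the products
`f₁ ∧ ⋯ ∧ f_p ∧ \bar g₁ ∧ ⋯ ∧ \bar g_q` with all `fᵢ`, `gⱼ` of type `(1,0)`. -/
def bidegree (p q : ℕ) : Submodule ℂ (V [⋀^Fin (p + q)]→L[ℝ] ℂ) :=
  Submodule.span ℂ {α | ∃ (f : Fin p → (V →L[ℂ] ℂ)) (g : Fin q → (V →L[ℂ] ℂ)),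
    α = wedge (wedgeFun f) (conj (wedgeFun g))}

/-- The constant `σ_p = i^{p²} 2^{-p}`. -/
def sigma (p : ℕ) : ℂ := Complex.I ^ (p ^ 2) * (2 ^ p)⁻¹

/-- The volume form `σ_n φ¹ ∧ ⋯ ∧ φⁿ ∧ \bar φ¹ ∧ ⋯ ∧ \bar φⁿ` of a basis
`φ¹, …, φⁿ` of the space of `(1,0)`-forms. -/
def vol {n : ℕ} (φ : Module.Basis (Fin n) ℂ (V →L[ℂ] ℂ)) : V [⋀^Fin (n + n)]→L[ℝ] ℂ :=
  sigma n • wedge (wedgeFun φ) (conj (wedgeFun φ))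

/-- A form of top degree is strictly positive if it is a positive multiple of a volume form. (Up to
positive multiples the volume form does not depend on the basis; the existence of a basis indexed
by `Fin n` forces `n` to be the complex dimension of `V`.) -/
def StrictlyPositive {m : ℕ} (τ : V [⋀^Fin m]→L[ℝ] ℂ) : Prop :=
  ∃ (n : ℕ) (φ : Module.Basis (Fin n) ℂ (V →L[ℂ] ℂ)) (h : m = n + n) (a : ℝ),
    0 < a ∧ castDeg h τ = (a : ℂ) • vol φ

/-- `Ω` is transverse if `σ_{n-p} Ω ∧ β ∧ \bar β` is strictly positive for every nonzero simple
`(n-p,0)`-form `β`, where `n` is the complex dimension of `V`. -/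
def IsTransverse {p : ℕ} (Ω : V [⋀^Fin (p + p)]→L[ℝ] ℂ) : Prop :=
  ∀ β : V [⋀^Fin (Module.finrank ℂ V - p)]→L[ℝ] ℂ, IsSimple β → β ≠ 0 →
    StrictlyPositive (sigma (Module.finrank ℂ V - p) • wedge (wedge Ω β) (conj β))

section Parts

variable {F : Type*} [NormedAddCommGroup F] [NormedSpace ℂ F]

/-- Multiplication by `i`, the complex structure. -/
def J (V : Type*) [NormedAddCommGroup V] [NormedSpace ℂ V] : V →L[ℝ] V :=
  (Complex.I • ContinuousLinearMap.id ℂ V).restrictScalars ℝ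

/-- The complex-linear part `v ↦ (L v - i L (i v)) / 2` of a real-linear map. -/
def linearPart (L : V →L[ℝ] F) : V →L[ℝ] F :=
  (1 / 2 : ℂ) • (L - Complex.I • L.comp (J V))

/-- The conjugate-linear part `v ↦ (L v + i L (i v)) / 2` of a real-linear map. -/
def antilinearPart (L : V →L[ℝ] F) : V →L[ℝ] F :=
  (1 / 2 : ℂ) • (L + Complex.I • L.comp (J V))

end Parts

end Pointwise

/-! ### Differential forms on a complex manifold `M` modelled on `E` -/

section Manifold

variable (E : Type*) [NormedAddCommGroup E] [NormedSpace ℂ E]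
  (M : Type*) [TopologicalSpace M] [ChartedSpace E M]

/-- Complex-valued differential `r`-forms on `M` (no regularity imposed). In Mathlib the tangent
space `TangentSpace 𝓘(ℂ, E) x` is by definition the vector space `E`. -/
abbrev Form (r : ℕ) : Type _ := M → E [⋀^Fin r]→L[ℝ] ℂ

variable {E M} {r : ℕ}

/-- The derivative at `y` of the inverse of the preferred chart at `x₀`, as a map from `E` to the
tangent space of `M` at the image of `y`. -/
def chartSymmDeriv (x₀ : M) (y : E) : E →L[ℂ] E :=
  mfderiv 𝓘(ℂ, E) 𝓘(ℂ, E) (chartAt E x₀).symm y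

/-- The derivative at `x` of the preferred chart at `x`, as a map from the tangent space of `M`
at `x` to `E`. -/
def chartDeriv (x : M) : E →L[ℂ] E :=
  mfderiv 𝓘(ℂ, E) 𝓘(ℂ, E) (chartAt E x) x

/-- The form `θ` read in the preferred chart at `x₀`: its pullback under the inverse chart. -/
def inChart (x₀ : M) (θ : Form E M r) (y : E) : E [⋀^Fin r]→L[ℝ] ℂ :=
  (θ ((chartAt E x₀).symm y)).compContinuousLinearMap ((chartSymmDeriv x₀ y).restrictScalars ℝ)

/-- Pullback to the tangent space at `x` of a form at the image of `x` in the preferred chart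
at `x`. -/
def fromChart (x : M) (α : E [⋀^Fin r]→L[ℝ] ℂ) : E [⋀^Fin r]→L[ℝ] ℂ :=
  α.compContinuousLinearMap ((chartDeriv x).restrictScalars ℝ)

/-- A form is smooth if it is `C^∞` (in the real sense) in charts. -/
def IsSmooth (θ : Form E M r) : Prop :=
  ∀ x₀ : M, ContDiffOn ℝ ∞ (inChart x₀ θ) (chartAt E x₀).target

/-- The exterior derivative `d`. -/
def d (θ : Form E M r) : Form E M (r + 1) := fun x =>
  fromChart x (extDeriv (inChart x θ) (chartAt E x x))

/-- The operator `∂`; in holomorphic coordinates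
`∂ (f dz_I ∧ d\bar z_J) = ∑ₖ ∂f/∂zₖ dzₖ ∧ dz_I ∧ d\bar z_J`. -/
def del (θ : Form E M r) : Form E M (r + 1) := fun x =>
  fromChart x (.alternatizeUncurryFin (linearPart (fderiv ℝ (inChart x θ) (chartAt E x x))))

/-- The operator `\bar ∂`; in holomorphic coordinates
`\bar ∂ (f dz_I ∧ d\bar z_J) = ∑ₖ ∂f/∂\bar zₖ d\bar zₖ ∧ dz_I ∧ d\bar z_J`. -/
def delbar (θ : Form E M r) : Form E M (r + 1) := fun x =>
  fromChart x (.alternatizeUncurryFin (antilinearPart (fderiv ℝ (inChart x θ) (chartAt E x x))))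

/-- `θ` is a smooth section of the bundle of forms of bidegree `(p,q)`. -/
def IsSmoothOfBidegree (p q : ℕ) (θ : Form E M (p + q)) : Prop :=
  IsSmooth θ ∧ ∀ x, θ x ∈ bidegree E p q

/-- `Ω` is a `p`-Kähler structure: a smooth real `(p,p)`-form that is transverse at each point
and `d`-closed. -/
structure IsPKahler (p : ℕ) (Ω : Form E M (p + p)) : Prop where
  smooth : IsSmoothOfBidegree p p Ω
  real : ∀ x, conj (Ω x) = Ω x
  transverse : ∀ x, IsTransverse (Ω x)
  closed : d Ω = 0

/-! ### Vanishing of cohomology classes of a form `Ω` of bidegree `(p,q)`, `p, q ≥ 1` -/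

/-- `[Ω]_{dR} = 0`: `Ω = dη` for a smooth form `η`. -/
def DeRhamClassVanishes {r : ℕ} (Ω : Form E M r) : Prop :=
  ∃ (s : ℕ) (h : s + 1 = r) (η : Form E M s), IsSmooth η ∧ ∀ x, Ω x = castDeg h (d η x)

/-- `[Ω]_∂ = 0`: `Ω = ∂λ` for a smooth `(p-1,q)`-form `λ`. -/
def DelClassVanishes (p q : ℕ) (Ω : Form E M (p + q)) : Prop :=
  ∃ (a : ℕ) (h : a + 1 = p) (lam : Form E M (a + q)), IsSmoothOfBidegree a q lam ∧
    ∀ x, Ω x = castDeg (by omega) (del lam x)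

/-- `[Ω]_{\bar ∂} = 0`: `Ω = \bar ∂ μ` for a smooth `(p,q-1)`-form `μ`. -/
def DelbarClassVanishes (p q : ℕ) (Ω : Form E M (p + q)) : Prop :=
  ∃ (b : ℕ) (h : b + 1 = q) (mu : Form E M (p + b)), IsSmoothOfBidegree p b mu ∧
    ∀ x, Ω x = castDeg (by omega) (delbar mu x)

/-- `[Ω]_A = 0`: `Ω = ∂λ + \bar ∂ μ` for a smooth `(p-1,q)`-form `λ` and a smooth
`(p,q-1)`-form `μ`. -/
def AeppliClassVanishes (p q : ℕ) (Ω : Form E M (p + q)) : Prop :=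
  ∃ (a b : ℕ) (ha : a + 1 = p) (hb : b + 1 = q) (lam : Form E M (a + q)) (mu : Form E M (p + b)),
    IsSmoothOfBidegree a q lam ∧ IsSmoothOfBidegree p b mu ∧
    ∀ x, Ω x = castDeg (by omega) (del lam x) + castDeg (by omega) (delbar mu x)

/-- `[Ω]_{BC} = 0`: `Ω = ∂ \bar ∂ η` for a smooth `(p-1,q-1)`-form `η`. -/
def BottChernClassVanishes (p q : ℕ) (Ω : Form E M (p + q)) : Prop :=
  ∃ (a b : ℕ) (ha : a + 1 = p) (hb : b + 1 = q) (η : Form E M (a + b)),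
    IsSmoothOfBidegree a b η ∧ ∀ x, Ω x = castDeg (by omega) (del (delbar η) x)

end Manifold

end PKahler

end

/-! Let `ξ` be a closed simple `(k,0)`-form. By transversality `σ_k Ω ∧ ξ ∧ \bar ξ` is a nonnegative
top form, strictly positive wherever `ξ ≠ 0`. If `Ω = dη`, then since `ξ` and `\bar ξ` are closed it
equals `σ_k d(η ∧ ξ ∧ \bar ξ)`, so by Stokes its integral over the compact `M` is zero. A
nonnegative continuous density with zero integral vanishes, hence `ξ = 0`. This is
`eq_zero_of_wedge_exact`, resting on the Leibniz rule `d_wedge_of_closed` and on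
`d_eq_zero_of_nonneg`.

The other four cases reduce to `Ω = ∂λ + \bar∂μ`, with one of `λ`, `μ` possibly zero and `λ =
\bar∂η` in the Bott–Chern case. Then `d(λ + μ)` is `Ω` plus `\bar∂λ + ∂μ`, of bidegrees `(p-1,p+1)`
and `(p+1,p-1)`; wedged with `ξ ∧ \bar ξ` these terms die, since a nonzero top form has type
`(n,n)`. So `Ω` is exact after wedging with `ξ ∧ \bar ξ`, which is all the first argument needs
(`eq_zero_of_del_add_delbar`).

Bidegrees enter only through weights: pullback by multiplication by `i` scales an `(a,b)`-form by
`i^(a-b)`. The unwanted terms have weight `-1`, while a top form always has weight `1` because the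
real determinant of a complex-linear map is `|det|²` (`HasWeight.eq_zero_of_top`). The same
determinant identity makes chart changes orientation-preserving, so integrals are taken chart by
chart with a partition of unity. -/

noncomputable section

namespace PKahler

/-! ### Reindexing signed sums over permutations. -/

section PermutationSums

/-- Conjugation by `e` preserves signs, so argument slots may be relabelled by any bijection without
a sign. -/
theorem sum_perm_equiv {ι κ V : Type*} [Fintype ι] [DecidableEq ι] [Fintype κ] [DecidableEq κ]
    (e : ι ≃ κ) (F : (ι → V) → ℂ) (v : κ → V) :
    ∑ σ : Equiv.Perm ι, Equiv.Perm.sign σ • F (fun i => v (e (σ i))) =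
      ∑ σ : Equiv.Perm κ, Equiv.Perm.sign σ • F (fun i => v (σ (e i))) := by
  rw [← Equiv.sum_comp e.permCongr]
  refine Finset.sum_congr rfl fun σ _ => ?_
  rw [Equiv.Perm.sign_permCongr]
  simp [Equiv.permCongr_apply]

/-- The bijection `(i, τ) ↦ (0 ↦ i, j + 1 ↦ i.succAbove (τ j))`. -/
def consPerm {n : ℕ} (x : Fin (n + 1) × Equiv.Perm (Fin n)) : Equiv.Perm (Fin (n + 1)) :=
  x.1.cycleRange.symm * Equiv.Perm.decomposeFin.symm (0, x.2)

theorem consPerm_zero {n : ℕ} (x : Fin (n + 1) × Equiv.Perm (Fin n)) : consPerm x 0 = x.1 := by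
  simp [consPerm]

theorem consPerm_succ {n : ℕ} (x : Fin (n + 1) × Equiv.Perm (Fin n)) (j : Fin n) :
    consPerm x j.succ = x.1.succAbove (x.2 j) := by
  simp [consPerm]

theorem sign_consPerm {n : ℕ} (x : Fin (n + 1) × Equiv.Perm (Fin n)) :
    Equiv.Perm.sign (consPerm x) = (-1) ^ (x.1 : ℕ) * Equiv.Perm.sign x.2 := by
  simp [consPerm, Equiv.Perm.decomposeFin.symm_sign]

theorem consPerm_bijective (n : ℕ) :
    Function.Bijective (consPerm : Fin (n + 1) × Equiv.Perm (Fin n) → _) := by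
  rw [Fintype.bijective_iff_injective_and_card]
  constructor
  · rintro ⟨i, τ⟩ ⟨j, τ'⟩ h
    have hij : i = j := by
      have := congrArg (fun σ : Equiv.Perm (Fin (n + 1)) => σ 0) h
      simpa [consPerm_zero] using this
    subst hij
    simpa [consPerm] using h
  · simp [Fintype.card_perm, Nat.factorial_succ]

/-- Splitting permutations by the image of `0` produces exactly the alternating sum that defines
`alternatizeUncurryFin`. -/
theorem sum_perm_succ {V : Type*} {n : ℕ} (F : V → (Fin n → V) → ℂ) (v : Fin (n + 1) → V) :
    ∑ σ : Equiv.Perm (Fin (n + 1)), Equiv.Perm.sign σ • F (v (σ 0)) (fun j => v (σ j.succ)) =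
      ∑ i : Fin (n + 1), (-1) ^ (i : ℕ) • ∑ τ : Equiv.Perm (Fin n),
        Equiv.Perm.sign τ • F (v i) (fun j => i.removeNth v (τ j)) := by
  rw [← (consPerm_bijective n).sum_comp, Fintype.sum_prod_type]
  refine Finset.sum_congr rfl fun i _ => ?_
  rw [Finset.smul_sum]
  refine Finset.sum_congr rfl fun τ _ => ?_
  simp only [consPerm_zero, consPerm_succ, sign_consPerm, mul_smul, Fin.removeNth]
  rcases Nat.even_or_odd (i : ℕ) with h | h <;> simp [h.neg_one_pow]

end PermutationSums

/-! ### The exterior product and its compatibility with alternation. -/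

section Algebra

variable {V : Type*} [NormedAddCommGroup V] [NormedSpace ℂ V]

/-- Each shuffle is represented by `r! s!` permutations. With the sum over the whole symmetric group
in place of the quotient, identities for `wedge` become reindexings, and the factorial is cancelled
at the end. -/
theorem wedge_apply_sum {r s : ℕ} (α : V [⋀^Fin r]→L[ℝ] ℂ) (β : V [⋀^Fin s]→L[ℝ] ℂ)
    (v : Fin (r + s) → V) :
    ((r.factorial * s.factorial : ℕ) : ℂ) * wedge α β v =
      ∑ σ : Equiv.Perm (Fin r ⊕ Fin s), Equiv.Perm.sign σ •
        (α (fun i => v (finSumFinEquiv (σ (Sum.inl i)))) *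
          β (fun i => v (finSumFinEquiv (σ (Sum.inr i))))) := by
  have h := congrArg (fun f => LinearMap.mul' ℝ ℂ (f fun i => v (finSumFinEquiv i)))
    (MultilinearMap.domCoprod_alternization_eq α.toAlternatingMap β.toAlternatingMap)
  simp only [Fintype.card_fin, AlternatingMap.smul_apply, map_nsmul,
    MultilinearMap.alternatization_apply, map_sum] at h
  rw [← nsmul_eq_mul]
  refine h.symm.trans (Finset.sum_congr rfl fun σ _ => ?_)
  rw [Units.smul_def, Units.smul_def, map_zsmul]
  rfl

theorem form_zero_apply {r : ℕ} (v : Fin r → V) : (0 : V [⋀^Fin r]→L[ℝ] ℂ) v = 0 := rfl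

theorem factorial_mul_ne_zero (r s : ℕ) : ((r.factorial * s.factorial : ℕ) : ℂ) ≠ 0 :=
  Nat.cast_ne_zero.mpr (mul_ne_zero r.factorial_ne_zero s.factorial_ne_zero)

theorem wedge_add_left {r s : ℕ} (α α' : V [⋀^Fin r]→L[ℝ] ℂ) (β : V [⋀^Fin s]→L[ℝ] ℂ) :
    wedge (α + α') β = wedge α β + wedge α' β := by
  ext v
  apply mul_left_cancel₀ (factorial_mul_ne_zero r s)
  rw [ContinuousAlternatingMap.add_apply, mul_add]
  simp only [wedge_apply_sum, ContinuousAlternatingMap.add_apply, add_mul, smul_add,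
    Finset.sum_add_distrib]

theorem wedge_add_right {r s : ℕ} (α : V [⋀^Fin r]→L[ℝ] ℂ) (β β' : V [⋀^Fin s]→L[ℝ] ℂ) :
    wedge α (β + β') = wedge α β + wedge α β' := by
  ext v
  apply mul_left_cancel₀ (factorial_mul_ne_zero r s)
  rw [ContinuousAlternatingMap.add_apply, mul_add]
  simp only [wedge_apply_sum, ContinuousAlternatingMap.add_apply, mul_add, smul_add,
    Finset.sum_add_distrib]

theorem wedge_smul_left {r s : ℕ} (c : ℂ) (α : V [⋀^Fin r]→L[ℝ] ℂ) (β : V [⋀^Fin s]→L[ℝ] ℂ) :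
    wedge (c • α) β = c • wedge α β := by
  ext v
  apply mul_left_cancel₀ (factorial_mul_ne_zero r s)
  rw [ContinuousAlternatingMap.smul_apply, mul_smul_comm]
  simp only [wedge_apply_sum, ContinuousAlternatingMap.smul_apply, smul_mul_assoc,
    Finset.smul_sum, smul_comm c]

theorem wedge_smul_right {r s : ℕ} (c : ℂ) (α : V [⋀^Fin r]→L[ℝ] ℂ) (β : V [⋀^Fin s]→L[ℝ] ℂ) :
    wedge α (c • β) = c • wedge α β := by
  ext v
  apply mul_left_cancel₀ (factorial_mul_ne_zero r s)
  rw [ContinuousAlternatingMap.smul_apply, mul_smul_comm]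
  simp only [wedge_apply_sum, ContinuousAlternatingMap.smul_apply, mul_smul_comm,
    Finset.smul_sum, smul_comm c]

theorem wedge_comp {W : Type*} [NormedAddCommGroup W] [NormedSpace ℂ W] {r s : ℕ}
    (α : V [⋀^Fin r]→L[ℝ] ℂ) (β : V [⋀^Fin s]→L[ℝ] ℂ) (A : W →L[ℝ] V) :
    (wedge α β).compContinuousLinearMap A =
      wedge (α.compContinuousLinearMap A) (β.compContinuousLinearMap A) := by
  ext v
  apply mul_left_cancel₀ (factorial_mul_ne_zero r s)
  rw [ContinuousAlternatingMap.compContinuousLinearMap_apply, wedge_apply_sum, wedge_apply_sum]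
  rfl

theorem wedge_zero_left {r s : ℕ} (β : V [⋀^Fin s]→L[ℝ] ℂ) :
    wedge (0 : V [⋀^Fin r]→L[ℝ] ℂ) β = 0 := by
  simpa using wedge_add_left (0 : V [⋀^Fin r]→L[ℝ] ℂ) 0 β

theorem wedge_zero_right {r s : ℕ} (α : V [⋀^Fin r]→L[ℝ] ℂ) :
    wedge α (0 : V [⋀^Fin s]→L[ℝ] ℂ) = 0 := by
  simpa using wedge_add_right α (0 : V [⋀^Fin s]→L[ℝ] ℂ) 0

theorem wedge_castDeg_left {r r' s : ℕ} (h : r = r') (α : V [⋀^Fin r]→L[ℝ] ℂ)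
    (β : V [⋀^Fin s]→L[ℝ] ℂ) :
    wedge (castDeg h α) β = castDeg (by rw [h]) (wedge α β) := by
  subst h
  rfl

/-- The conjugation of forms as a continuous real-linear map. -/
def conjL (V : Type*) [NormedAddCommGroup V] [NormedSpace ℂ V] (r : ℕ) :
    (V [⋀^Fin r]→L[ℝ] ℂ) →L[ℝ] (V [⋀^Fin r]→L[ℝ] ℂ) :=
  ContinuousLinearMap.compContinuousAlternatingMapCLM ℝ V ℂ ℂ (Fin r) (Complex.conjCLE : ℂ →L[ℝ] ℂ)

theorem altUncurry_conj {r : ℕ} (L : V →L[ℝ] (V [⋀^Fin r]→L[ℝ] ℂ)) :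
    ContinuousAlternatingMap.alternatizeUncurryFin ((conjL V r).comp L) =
      conj (ContinuousAlternatingMap.alternatizeUncurryFin L) := by
  ext v
  have h : conj (ContinuousAlternatingMap.alternatizeUncurryFin L) v =
    Complex.conjCLE (ContinuousAlternatingMap.alternatizeUncurryFin L v) := rfl
  rw [h, ContinuousAlternatingMap.alternatizeUncurryFin_apply,
    ContinuousAlternatingMap.alternatizeUncurryFin_apply, map_sum]
  refine Finset.sum_congr rfl fun i _ => ?_
  rw [map_zsmul]
  rfl

-- A form is determined by its values on tuples of basis vectors. Finite dimension makes the
-- bilinear exterior product continuous, as the product rule for `fderiv` requires.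
variable (V) in
theorem finiteDimensional_forms [FiniteDimensional ℂ V] (r : ℕ) :
    FiniteDimensional ℝ (V [⋀^Fin r]→L[ℝ] ℂ) := by
  let b := Module.finBasis ℝ V
  let ev : (V [⋀^Fin r]→L[ℝ] ℂ) →ₗ[ℝ] ((Fin r → Fin (Module.finrank ℝ V)) → ℂ) :=
    { toFun := fun α t => α fun i => b (t i)
      map_add' := fun _ _ => rfl
      map_smul' := fun _ _ => rfl }
  refine FiniteDimensional.of_injective ev fun α β h => ?_
  apply ContinuousAlternatingMap.toAlternatingMap_injective
  exact AlternatingMap.coe_multilinearMap_injective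
    (Module.Basis.ext_multilinear (fun _ => b) fun t => congrFun h t)

theorem ofReal_smul_form {r : ℕ} (c : ℝ) (α : V [⋀^Fin r]→L[ℝ] ℂ) : (c : ℂ) • α = c • α := by
  ext v
  exact Complex.coe_smul c (α v)

/-- The exterior product as a continuous bilinear map. -/
def wedgeL (V : Type*) [NormedAddCommGroup V] [NormedSpace ℂ V] [FiniteDimensional ℂ V]
    (r s : ℕ) : (V [⋀^Fin r]→L[ℝ] ℂ) →L[ℝ] (V [⋀^Fin s]→L[ℝ] ℂ) →L[ℝ]
      (V [⋀^Fin (r + s)]→L[ℝ] ℂ) :=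
  haveI := finiteDimensional_forms V r
  haveI := finiteDimensional_forms V s
  LinearMap.toContinuousBilinearMap (LinearMap.mk₂ ℝ wedge wedge_add_left
    (fun c α β => by simp only [← ofReal_smul_form, wedge_smul_left]) wedge_add_right
    (fun c α β => by simp only [← ofReal_smul_form, wedge_smul_right]))

theorem wedgeL_apply [FiniteDimensional ℂ V] {r s : ℕ} (α : V [⋀^Fin r]→L[ℝ] ℂ)
    (β : V [⋀^Fin s]→L[ℝ] ℂ) : wedgeL V r s α β = wedge α β := rfl

/-- Summing over permutations absorbs the alternation of the first factor. -/
theorem sum_perm_altUncurry {r : ℕ} {κ : Type*} [Fintype κ] [DecidableEq κ]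
    (L : V →L[ℝ] (V [⋀^Fin r]→L[ℝ] ℂ)) (G : (κ → V) → ℂ) (w : Fin (r + 1) ⊕ κ → V) :
    ∑ σ : Equiv.Perm (Fin (r + 1) ⊕ κ), Equiv.Perm.sign σ •
        (ContinuousAlternatingMap.alternatizeUncurryFin L (fun i => w (σ (Sum.inl i))) *
          G (fun i => w (σ (Sum.inr i)))) =
      (r + 1) * ∑ σ : Equiv.Perm (Fin (r + 1) ⊕ κ), Equiv.Perm.sign σ •
        (L (w (σ (Sum.inl 0))) (fun i => w (σ (Sum.inl i.succ))) *
          G (fun i => w (σ (Sum.inr i)))) := by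
  simp only [ContinuousAlternatingMap.alternatizeUncurryFin_apply, Finset.sum_mul,
    Finset.smul_sum]
  rw [Finset.sum_comm]
  have key : ∀ i : Fin (r + 1), ∑ σ : Equiv.Perm (Fin (r + 1) ⊕ κ), Equiv.Perm.sign σ •
        (((-1) ^ (i : ℕ) • L (w (σ (Sum.inl i))) (i.removeNth fun i => w (σ (Sum.inl i)))) *
          G (fun i => w (σ (Sum.inr i)))) = ∑ σ : Equiv.Perm (Fin (r + 1) ⊕ κ),
        Equiv.Perm.sign σ • (L (w (σ (Sum.inl 0))) (fun i => w (σ (Sum.inl i.succ))) *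
          G (fun i => w (σ (Sum.inr i)))) := by
    intro i
    -- Precomposing with the cycle that moves slot `i` to the front has sign `(-1)^i`, which cancels
    -- the sign of the `i`-th term. All `r + 1` terms therefore give the same sum.
    rw [← Equiv.sum_comp (Equiv.mulRight (Equiv.Perm.sumCongr i.cycleRange.symm (1 : Equiv.Perm κ)))
      (fun σ : Equiv.Perm (Fin (r + 1) ⊕ κ) =>
        Equiv.Perm.sign σ • (L (w (σ (Sum.inl 0))) (fun i => w (σ (Sum.inl i.succ))) *
          G (fun i => w (σ (Sum.inr i)))))]
    refine Finset.sum_congr rfl fun σ _ => ?_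
    simp only [Equiv.coe_mulRight, Equiv.Perm.mul_apply, Equiv.Perm.sumCongr_apply, Sum.map_inl,
      Sum.map_inr, Fin.cycleRange_symm_zero, Fin.cycleRange_symm_succ, Equiv.Perm.sign_mul,
      Equiv.Perm.sign_sumCongr, Equiv.Perm.sign_symm, Fin.sign_cycleRange, Equiv.Perm.sign_one,
      Equiv.Perm.one_apply, mul_one]
    rw [mul_smul]
    congr 1
    rcases Nat.even_or_odd (i : ℕ) with h2 | h2 <;> simp [h2.neg_one_pow]
    all_goals exact Or.inl rfl
  rw [Finset.sum_congr rfl fun i _ => key i]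
  simp [Finset.mul_sum]

/-- Half of the Leibniz rule, at the level of linear algebra: `L` plays the derivative of the first
factor. Both sides, scaled by factorials, are one sum over permutations of all `r + s + 1` slots. -/
theorem altUncurry_wedge_left [FiniteDimensional ℂ V] {r s : ℕ}
    (L : V →L[ℝ] (V [⋀^Fin r]→L[ℝ] ℂ)) (β : V [⋀^Fin s]→L[ℝ] ℂ) :
    ContinuousAlternatingMap.alternatizeUncurryFin (((wedgeL V r s).flip β).comp L) =
      castDeg (by omega) (wedge (ContinuousAlternatingMap.alternatizeUncurryFin L) β) := by
  have hdeg : r + 1 + s = r + s + 1 := by omega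
  ext v
  apply mul_left_cancel₀ (factorial_mul_ne_zero (r + 1) s)
  let e : Fin (r + 1) ⊕ Fin s ≃ Fin (r + s + 1) := finSumFinEquiv.trans (finCongr hdeg)
  have hR : ((((r + 1).factorial * s.factorial : ℕ) : ℂ) *
      castDeg hdeg (wedge (ContinuousAlternatingMap.alternatizeUncurryFin L) β) v) = _ :=
    (wedge_apply_sum (ContinuousAlternatingMap.alternatizeUncurryFin L) β
      (fun i => v (finCongr hdeg i))).trans
      (sum_perm_altUncurry L β (fun i => v (e i)))
  rw [hR, sum_perm_equiv e (fun w => L (w (Sum.inl 0)) (fun i => w (Sum.inl i.succ)) *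
    β (fun i => w (Sum.inr i)))]
  have h0 : e (Sum.inl 0) = 0 := by ext; simp [e]
  have h1 : ∀ i : Fin r, e (Sum.inl i.succ) = (finSumFinEquiv (Sum.inl i)).succ := by
    intro i; ext; simp [e]
  have h2 : ∀ i : Fin s, e (Sum.inr i) = (finSumFinEquiv (Sum.inr i)).succ := by
    intro i; ext; simp [e]; omega
  simp only [h0, h1, h2]
  have hS : ((r.factorial * s.factorial : ℕ) : ℂ) *
      ContinuousAlternatingMap.alternatizeUncurryFin (((wedgeL V r s).flip β).comp L) v =
      ∑ σ : Equiv.Perm (Fin (r + s + 1)), Equiv.Perm.sign σ •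
        (L (v (σ 0)) (fun i => v (σ (finSumFinEquiv (Sum.inl i)).succ)) *
          β (fun i => v (σ (finSumFinEquiv (Sum.inr i)).succ))) := by
    rw [sum_perm_succ (fun x w => L x (fun i => w (finSumFinEquiv (Sum.inl i))) *
      β (fun i => w (finSumFinEquiv (Sum.inr i)))),
      ContinuousAlternatingMap.alternatizeUncurryFin_apply, Finset.mul_sum]
    refine Finset.sum_congr rfl fun i _ => ?_
    rw [← sum_perm_equiv finSumFinEquiv (fun w => L (v i) (fun i => w (Sum.inl i)) *
      β (fun i => w (Sum.inr i))), ← wedge_apply_sum]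
    simp only [ContinuousLinearMap.comp_apply, ContinuousLinearMap.flip_apply, wedgeL_apply,
      mul_smul_comm]
  rw [← hS, Nat.factorial_succ]
  push_cast
  ring

/-- The other half of the Leibniz rule, for a closed second factor. The general sign `(-1)^r` never
has to be tracked because the term vanishes. -/
theorem altUncurry_wedge_right [FiniteDimensional ℂ V] {r s : ℕ} (α : V [⋀^Fin r]→L[ℝ] ℂ)
    (L : V →L[ℝ] (V [⋀^Fin s]→L[ℝ] ℂ))
    (hL : ContinuousAlternatingMap.alternatizeUncurryFin L = 0) :
    ContinuousAlternatingMap.alternatizeUncurryFin ((wedgeL V r s α).comp L) = 0 := by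
  ext v
  apply mul_left_cancel₀ (factorial_mul_ne_zero r s)
  -- The order of slots is: direction of differentiation, arguments of `α`, remaining arguments of
  -- `L`. The left summand collects all arguments of `L`, so that its alternation can be recognised.
  let e0 : Fin (s + 1) ⊕ Fin r → Fin (r + s + 1) :=
    Sum.elim (Fin.cases 0 fun j => (finSumFinEquiv (Sum.inr j)).succ)
      fun i => (finSumFinEquiv (Sum.inl i)).succ
  have he : Function.Bijective e0 := by
    rw [Fintype.bijective_iff_injective_and_card]
    refine ⟨?_, by simp; omega⟩
    rintro (a | a) (b | b)
    · refine Fin.cases ?_ (fun a => ?_) a <;> refine Fin.cases ?_ (fun b => ?_) b <;>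
        simp [e0, Fin.ext_iff]
    · refine Fin.cases ?_ (fun a => ?_) a <;> simp [e0, Fin.ext_iff]
      omega
    · refine Fin.cases ?_ (fun b => ?_) b <;> simp [e0, Fin.ext_iff]
      omega
    · simp [e0, Fin.ext_iff]
  let e := Equiv.ofBijective e0 he
  have h := sum_perm_altUncurry L α (fun i => v (e i))
  rw [hL] at h
  simp only [form_zero_apply, zero_mul, smul_zero,
    Finset.sum_const_zero] at h
  have h' := (mul_eq_zero.mp h.symm).resolve_left (by exact_mod_cast Nat.succ_ne_zero s)
  rw [sum_perm_equiv e (fun w => L (w (Sum.inl 0)) (fun i => w (Sum.inl i.succ)) *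
    α (fun i => w (Sum.inr i)))] at h'
  have h0 : e (Sum.inl 0) = 0 := rfl
  have h1 : ∀ i : Fin s, e (Sum.inl i.succ) = (finSumFinEquiv (Sum.inr i)).succ := fun _ => rfl
  have h2 : ∀ i : Fin r, e (Sum.inr i) = (finSumFinEquiv (Sum.inl i)).succ := fun _ => rfl
  simp only [h0, h1, h2] at h'
  rw [sum_perm_succ (fun x w => L x (fun i => w (finSumFinEquiv (Sum.inr i))) *
    α (fun i => w (finSumFinEquiv (Sum.inl i))))] at h'
  rw [form_zero_apply, mul_zero, ← h',
    ContinuousAlternatingMap.alternatizeUncurryFin_apply, Finset.mul_sum]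
  refine Finset.sum_congr rfl fun i _ => ?_
  rw [← sum_perm_equiv finSumFinEquiv (fun w => L (v i) (fun i => w (Sum.inr i)) *
    α (fun i => w (Sum.inl i)))]
  simp only [mul_comm (L _ _)]
  rw [← wedge_apply_sum]
  simp only [ContinuousLinearMap.comp_apply, wedgeL_apply, mul_smul_comm]

end Algebra

/-! ### Weights under multiplication by `i`, a substitute for bidegree. -/

section Weights

variable {V : Type*} [NormedAddCommGroup V] [NormedSpace ℂ V]

/-- The form `α` is an eigenvector, with eigenvalue `c`, of the pullback under multiplication
by `i`. -/
def HasWeight {r : ℕ} (c : ℂ) (α : V [⋀^Fin r]→L[ℝ] ℂ) : Prop :=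
  α.compContinuousLinearMap (J V) = c • α

theorem hasWeight_iff {r : ℕ} {c : ℂ} {α : V [⋀^Fin r]→L[ℝ] ℂ} :
    HasWeight c α ↔ ∀ v, α (fun i => Complex.I • v i) = c * α v :=
  ⟨fun h v => DFunLike.congr_fun h v, fun h => ContinuousAlternatingMap.ext h⟩

theorem HasWeight.add {r : ℕ} {c : ℂ} {α β : V [⋀^Fin r]→L[ℝ] ℂ} (hα : HasWeight c α)
    (hβ : HasWeight c β) : HasWeight c (α + β) := by
  rw [hasWeight_iff] at *
  intro v
  rw [ContinuousAlternatingMap.add_apply, ContinuousAlternatingMap.add_apply, hα, hβ, mul_add]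

theorem form_eq_zero_of_smul {r : ℕ} {c : ℂ} (hc : c ≠ 0) {α : V [⋀^Fin r]→L[ℝ] ℂ}
    (h : c • α = 0) : α = 0 := by
  ext v
  exact (mul_eq_zero.mp (DFunLike.congr_fun h v)).resolve_left hc

theorem hasWeight_zero {r : ℕ} (c : ℂ) : HasWeight c (0 : V [⋀^Fin r]→L[ℝ] ℂ) :=
  hasWeight_iff.mpr fun v => by simp [form_zero_apply]

theorem HasWeight.smul {r : ℕ} {c : ℂ} {α : V [⋀^Fin r]→L[ℝ] ℂ} (hα : HasWeight c α)
    (a : ℂ) : HasWeight c (a • α) := by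
  rw [hasWeight_iff] at *
  intro v
  rw [ContinuousAlternatingMap.smul_apply, ContinuousAlternatingMap.smul_apply, hα,
    smul_eq_mul, smul_eq_mul, mul_left_comm]

theorem HasWeight.conj {r : ℕ} {c : ℂ} {α : V [⋀^Fin r]→L[ℝ] ℂ} (hα : HasWeight c α) :
    HasWeight (starRingEnd ℂ c) (conj α) := by
  rw [hasWeight_iff] at *
  intro v
  exact (congrArg (starRingEnd ℂ) (hα v)).trans (map_mul _ _ _)

theorem HasWeight.wedge {r s : ℕ} {c c' : ℂ} {α : V [⋀^Fin r]→L[ℝ] ℂ}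
    {β : V [⋀^Fin s]→L[ℝ] ℂ} (hα : HasWeight c α) (hβ : HasWeight c' β) :
    HasWeight (c * c') (wedge α β) := by
  unfold HasWeight at *
  rw [wedge_comp, hα, hβ, wedge_smul_left, wedge_smul_right, smul_smul]

theorem HasWeight.castDeg {r s : ℕ} (h : r = s) {c : ℂ} {α : V [⋀^Fin r]→L[ℝ] ℂ}
    (hα : HasWeight c α) : HasWeight c (castDeg h α) := by
  subst h
  exact hα

theorem hasWeight_wedgeFun {k : ℕ} (f : Fin k → (V →L[ℂ] ℂ)) :
    HasWeight (Complex.I ^ k) (wedgeFun f) := by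
  rw [hasWeight_iff]
  intro v
  rw [wedgeFun_apply, wedgeFun_apply]
  have : (Matrix.of fun i j => f i (Complex.I • v j)) =
      Complex.I • Matrix.of fun i j => f i (v j) := by
    ext i j
    simp
  rw [this, Matrix.det_smul, Fintype.card_fin]

/-- Having a given weight is a linear condition, so the generators suffice. The weight `i^(p-q)`
remembers `p - q` modulo 4, which is enough to separate the types that occur. -/
theorem hasWeight_of_mem_bidegree {p q : ℕ} {α : V [⋀^Fin (p + q)]→L[ℝ] ℂ}
    (h : α ∈ bidegree V p q) : HasWeight (Complex.I ^ p * (-Complex.I) ^ q) α := by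
  induction h using Submodule.span_induction with
  | mem α h =>
    obtain ⟨f, g, rfl⟩ := h
    refine (hasWeight_wedgeFun f).wedge ?_
    simpa using (hasWeight_wedgeFun g).conj
  | zero => exact hasWeight_zero _
  | add α β _ _ hα hβ => exact hα.add hβ
  | smul a α _ hα => exact hα.smul a

theorem linearPart_add_antilinearPart {F : Type*} [NormedAddCommGroup F] [NormedSpace ℂ F]
    (L : V →L[ℝ] F) : linearPart L + antilinearPart L = L := by
  unfold linearPart antilinearPart
  rw [← smul_add, sub_add_add_cancel, ← two_smul ℂ L, smul_smul]
  norm_num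

theorem linearPart_I_smul {F : Type*} [NormedAddCommGroup F] [NormedSpace ℂ F]
    (L : V →L[ℝ] F) (v : V) : linearPart L (Complex.I • v) = Complex.I • linearPart L v := by
  have h : ∀ w, linearPart L w = (1 / 2 : ℂ) • (L w - Complex.I • L (Complex.I • w)) :=
    fun _ => rfl
  rw [h, h, smul_smul Complex.I Complex.I, Complex.I_mul_I, neg_one_smul, map_neg,
    smul_comm Complex.I, smul_sub Complex.I, smul_smul Complex.I Complex.I, Complex.I_mul_I]
  congr 1
  simp
  abel

theorem antilinearPart_I_smul {F : Type*} [NormedAddCommGroup F] [NormedSpace ℂ F]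
    (L : V →L[ℝ] F) (v : V) :
    antilinearPart L (Complex.I • v) = -Complex.I • antilinearPart L v := by
  have h : ∀ w, antilinearPart L w = (1 / 2 : ℂ) • (L w + Complex.I • L (Complex.I • w)) :=
    fun _ => rfl
  rw [h, h, smul_smul Complex.I Complex.I, Complex.I_mul_I, neg_one_smul, map_neg,
    smul_comm (-Complex.I), smul_add (-Complex.I), smul_smul (-Complex.I) Complex.I, neg_mul,
    Complex.I_mul_I]
  congr 1
  simp
  abel

/-- In each term one vector goes into `L`, contributing `a`, and the others go into the resulting
form, contributing `c`. -/
theorem hasWeight_altUncurry {r : ℕ} {c a : ℂ} (L : V →L[ℝ] (V [⋀^Fin r]→L[ℝ] ℂ))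
    (hL : ∀ v, HasWeight c (L v)) (ha : ∀ v, L (Complex.I • v) = a • L v) :
    HasWeight (a * c) (ContinuousAlternatingMap.alternatizeUncurryFin L) := by
  rw [hasWeight_iff]
  intro v
  rw [ContinuousAlternatingMap.alternatizeUncurryFin_apply,
    ContinuousAlternatingMap.alternatizeUncurryFin_apply, Finset.mul_sum]
  refine Finset.sum_congr rfl fun i _ => ?_
  have h : (L (Complex.I • v i)) (i.removeNth fun i => Complex.I • v i) =
      a * c * L (v i) (i.removeNth v) := by
    rw [ha, ContinuousAlternatingMap.smul_apply, smul_eq_mul, mul_assoc]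
    exact congrArg _ (hasWeight_iff.mp (hL (v i)) (i.removeNth v))
  rw [h, mul_smul_comm]

theorem hasWeight_linearPart_apply {r : ℕ} {c : ℂ} {L : V →L[ℝ] (V [⋀^Fin r]→L[ℝ] ℂ)}
    (hL : ∀ v, HasWeight c (L v)) (v : V) : HasWeight c (linearPart L v) := by
  have h : linearPart L v = (1 / 2 : ℂ) • (L v + (-Complex.I) • L (Complex.I • v)) := by
    ext w
    change (1 / 2 : ℂ) * (L v w - Complex.I * L (Complex.I • v) w) =
      (1 / 2 : ℂ) * (L v w + -Complex.I * L (Complex.I • v) w)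
    ring
  rw [h]
  exact ((hL v).add ((hL _).smul _)).smul _

theorem hasWeight_antilinearPart_apply {r : ℕ} {c : ℂ} {L : V →L[ℝ] (V [⋀^Fin r]→L[ℝ] ℂ)}
    (hL : ∀ v, HasWeight c (L v)) (v : V) : HasWeight c (antilinearPart L v) :=
  ((hL v).add ((hL _).smul Complex.I)).smul (1 / 2)

theorem hasWeight_altUncurry_linearPart {r : ℕ} {c : ℂ} {L : V →L[ℝ] (V [⋀^Fin r]→L[ℝ] ℂ)}
    (hL : ∀ v, HasWeight c (L v)) :
    HasWeight (Complex.I * c) (ContinuousAlternatingMap.alternatizeUncurryFin (linearPart L)) :=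
  hasWeight_altUncurry _ (hasWeight_linearPart_apply hL) (linearPart_I_smul L)

theorem hasWeight_altUncurry_antilinearPart {r : ℕ} {c : ℂ}
    {L : V →L[ℝ] (V [⋀^Fin r]→L[ℝ] ℂ)} (hL : ∀ v, HasWeight c (L v)) :
    HasWeight (-Complex.I * c)
      (ContinuousAlternatingMap.alternatizeUncurryFin (antilinearPart L)) :=
  hasWeight_altUncurry _ (hasWeight_antilinearPart_apply hL) (antilinearPart_I_smul L)

theorem HasWeight.comp {W : Type*} [NormedAddCommGroup W] [NormedSpace ℂ W] {r : ℕ} {c : ℂ}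
    {α : V [⋀^Fin r]→L[ℝ] ℂ} (hα : HasWeight c α) (A : W →L[ℂ] V) :
    HasWeight c (α.compContinuousLinearMap (A.restrictScalars ℝ)) := by
  rw [hasWeight_iff] at *
  intro v
  have := hα (fun i => A (v i))
  simp only [← map_smul] at this
  exact this

end Weights

/-! ### Top-degree forms, determinants and the positive ray of volume forms. -/

section TopForms

variable {V : Type*} [NormedAddCommGroup V] [NormedSpace ℂ V]

/-- The real and imaginary parts are real top forms, hence multiples of `b.det`. -/
theorem top_form_apply {m : ℕ} (b : Module.Basis (Fin m) ℝ V) (α : V [⋀^Fin m]→L[ℝ] ℂ)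
    (v : Fin m → V) : α v = (b.det v : ℂ) * α b := by
  have hre := DFunLike.congr_fun (AlternatingMap.eq_smul_basis_det b
    (Complex.reLm.compAlternatingMap α.toAlternatingMap)) v
  have him := DFunLike.congr_fun (AlternatingMap.eq_smul_basis_det b
    (Complex.imLm.compAlternatingMap α.toAlternatingMap)) v
  have hre' : (α v).re = (α b).re * b.det v := hre
  have him' : (α v).im = (α b).im * b.det v := him
  apply Complex.ext
  · rw [Complex.re_ofReal_mul, hre', mul_comm]
  · rw [Complex.im_ofReal_mul, him', mul_comm]

theorem top_form_comp {m : ℕ} (b : Module.Basis (Fin m) ℝ V) (α : V [⋀^Fin m]→L[ℝ] ℂ)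
    (A : V →L[ℝ] V) :
    α.compContinuousLinearMap A = ((LinearMap.det (A : V →ₗ[ℝ] V) : ℝ) : ℂ) • α := by
  ext v
  rw [ContinuousAlternatingMap.smul_apply, smul_eq_mul,
    ContinuousAlternatingMap.compContinuousLinearMap_apply, top_form_apply b α v,
    top_form_apply b α]
  rw [show (⇑A ∘ v) = ((A : V →ₗ[ℝ] V) ∘ v) from rfl, Module.Basis.det_comp]
  push_cast
  ring

/-- The real determinant is the norm from `ℂ` to `ℝ` of the complex one. Its nonnegativity is what
makes positivity and integration independent of holomorphic coordinates. -/
theorem det_restrictScalars_complex [FiniteDimensional ℂ V] (A : V →L[ℂ] V) :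
    LinearMap.det ((A.restrictScalars ℝ : V →L[ℝ] V) : V →ₗ[ℝ] V) =
      Complex.normSq (LinearMap.det (A : V →ₗ[ℂ] V)) := by
  rw [← Algebra.norm_complex_apply, ← LinearMap.det_restrictScalars]
  rfl

/-- Multiplication by `i` has real determinant `|i^n|² = 1`, so it acts trivially on top forms. -/
theorem HasWeight.eq_zero_of_top [FiniteDimensional ℂ V] {m : ℕ} {c : ℂ}
    {α : V [⋀^Fin m]→L[ℝ] ℂ} (hα : HasWeight c α) (hm : Module.finrank ℝ V = m) (hc : c ≠ 1) :
    α = 0 := by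
  have h := top_form_comp (Module.finBasisOfFinrankEq ℝ V hm) α (J V)
  rw [hα, J, det_restrictScalars_complex] at h
  have hdet : LinearMap.det ((Complex.I • ContinuousLinearMap.id ℂ V : V →L[ℂ] V) : V →ₗ[ℂ] V) =
      Complex.I ^ Module.finrank ℂ V := by
    rw [ContinuousLinearMap.toLinearMap_smul, LinearMap.det_smul]
    simp
  rw [hdet, map_pow, Complex.normSq_I, one_pow, Complex.ofReal_one] at h
  have h2 : (c - 1) • α = 0 := by
    ext v
    have hv : c * α v = 1 * α v := DFunLike.congr_fun h v
    change (c - 1) * α v = 0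
    rw [sub_mul, hv, sub_self]
  exact form_eq_zero_of_smul (sub_ne_zero.mpr hc) h2

/-- A product of covectors, complex- or conjugate-linear, before alternation. -/
def prodMultilinear {k : ℕ} (f : Fin k → (V →ₗ[ℝ] ℂ)) : MultilinearMap ℝ (fun _ : Fin k => V) ℂ :=
  (MultilinearMap.mkPiAlgebra ℝ (Fin k) ℂ).compLinearMap f

theorem alternatization_prodMultilinear {k : ℕ} (f : Fin k → (V →ₗ[ℝ] ℂ)) (v : Fin k → V) :
    MultilinearMap.alternatization (prodMultilinear f) v =
      Matrix.det (Matrix.of fun i j => f i (v j)) := by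
  rw [← Matrix.det_transpose, Matrix.det_apply, MultilinearMap.alternatization_apply]
  simp [prodMultilinear, MultilinearMap.domDomCongr_apply, Matrix.transpose_apply]

/-- Both factors are alternatizations of products of covectors, so their exterior product is the
alternatization of the full product, that is, a Leibniz expansion. -/
theorem wedge_wedgeFun_conj_apply {k l : ℕ} (f : Fin k → (V →L[ℂ] ℂ)) (g : Fin l → (V →L[ℂ] ℂ))
    (v : Fin (k + l) → V) :
    wedge (wedgeFun f) (conj (wedgeFun g)) v =
      Matrix.det (Matrix.of fun i j : Fin k ⊕ Fin l =>
        Sum.elim (fun a => f a (v (finSumFinEquiv j)))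
          (fun a => starRingEnd ℂ (g a (v (finSumFinEquiv j)))) i) := by
  let f' : Fin k → (V →ₗ[ℝ] ℂ) := fun i => ((f i).restrictScalars ℝ : V →L[ℝ] ℂ)
  let g' : Fin l → (V →ₗ[ℝ] ℂ) := fun i =>
    (((Complex.conjCLE : ℂ →L[ℝ] ℂ).comp ((g i).restrictScalars ℝ) : V →L[ℝ] ℂ))
  have hf : (wedgeFun f).toAlternatingMap = MultilinearMap.alternatization (prodMultilinear f') := by
    ext v
    rw [alternatization_prodMultilinear]
    exact wedgeFun_apply f v
  have hg : (conj (wedgeFun g)).toAlternatingMap =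
      MultilinearMap.alternatization (prodMultilinear g') := by
    ext v
    rw [alternatization_prodMultilinear]
    refine (congrArg (starRingEnd ℂ) (wedgeFun_apply g v)).trans ?_
    rw [RingHom.map_det]
    rfl
  have h : wedge (wedgeFun f) (conj (wedgeFun g)) v = LinearMap.mul' ℝ ℂ
      ((wedgeFun f).toAlternatingMap.domCoprod (conj (wedgeFun g)).toAlternatingMap
        fun i => v (finSumFinEquiv i)) := rfl
  rw [h, hf, hg, ← MultilinearMap.domCoprod_alternization, MultilinearMap.alternatization_apply,
    map_sum, ← Matrix.det_transpose, Matrix.det_apply]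
  refine Finset.sum_congr rfl fun σ _ => ?_
  rw [Units.smul_def, Units.smul_def, map_zsmul]
  congr 1
  rw [Fintype.prod_sum_type]
  rfl

variable [FiniteDimensional ℂ V]

variable (V) in
/-- The coordinate functionals of a fixed basis. -/
def refCoord (i : Fin (Module.finrank ℂ V)) : V →L[ℂ] ℂ :=
  LinearMap.toContinuousLinearMap ((Module.finBasis ℂ V).coord i)

variable (V) in
/-- The volume form of a fixed basis. -/
def refVol : V [⋀^Fin (Module.finrank ℂ V + Module.finrank ℂ V)]→L[ℝ] ℂ :=
  sigma (Module.finrank ℂ V) • wedge (wedgeFun (refCoord V)) (conj (wedgeFun (refCoord V)))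

theorem sigma_ne_zero (n : ℕ) : sigma n ≠ 0 := by
  simp [sigma]

variable (V) in
theorem refVol_ne_zero : refVol V ≠ 0 := by
  intro h
  rw [refVol] at h
  have h1 := form_eq_zero_of_smul (sigma_ne_zero _) h
  let e := Module.finBasis ℂ V
  -- On the real basis `e_j, i e_j` the block determinant is `(-2i)^n`, which is nonzero.
  let w : Fin (Module.finrank ℂ V) ⊕ Fin (Module.finrank ℂ V) → V :=
    Sum.elim e (fun i => Complex.I • e i)
  have h2 := DFunLike.congr_fun h1 (fun i => w (finSumFinEquiv.symm i))
  rw [wedge_wedgeFun_conj_apply] at h2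
  have hm : (Matrix.of fun i j : Fin (Module.finrank ℂ V) ⊕ Fin (Module.finrank ℂ V) =>
        Sum.elim (fun a => refCoord V a (w (finSumFinEquiv.symm (finSumFinEquiv j))))
          (fun a => starRingEnd ℂ (refCoord V a (w (finSumFinEquiv.symm (finSumFinEquiv j))))) i) =
      Matrix.fromBlocks 1 (Complex.I • 1) 1 (-Complex.I • 1) := by
    ext i j
    rcases i with i | i <;> rcases j with j | j <;>
    by_cases hij : i = j <;>
    simp [w, refCoord, e, Finsupp.single_apply, hij, Ne.symm]
  rw [hm, Matrix.det_fromBlocks_one₁₁, one_mul, ← sub_smul, Matrix.det_smul] at h2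
  simp only [Matrix.det_one, mul_one, form_zero_apply] at h2
  have h3 := eq_zero_of_pow_eq_zero h2
  have h4 := congrArg Complex.im h3
  norm_num at h4

/-- Every basis `φ` of covectors is the pullback of the reference coordinates by an automorphism
`A`, so its volume form is `|det A|²` times the reference one. Strict positivity can thus be tested
against a single form. -/
theorem StrictlyPositive.exists_refVol {m : ℕ} {τ : V [⋀^Fin m]→L[ℝ] ℂ}
    (hτ : StrictlyPositive τ) (hm : m = Module.finrank ℂ V + Module.finrank ℂ V) :
    ∃ a : ℝ, 0 < a ∧ castDeg hm τ = (a : ℂ) • refVol V := by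
  obtain ⟨n, φ, h, a, ha, hφ⟩ := hτ
  obtain rfl : n = Module.finrank ℂ V := by omega
  let e := Module.finBasis ℂ V
  let A : V →L[ℂ] V := ∑ j, (φ j).smulRight (e j)
  have hA : ∀ v, A v = ∑ j, φ j v • e j := fun v => by simp [A]
  have hcoord : ∀ i v, refCoord V i (A v) = φ i v := by
    intro i v
    rw [hA]
    simp [refCoord, e, Finsupp.single_apply]
  have hinj : Function.Injective A := by
    rw [injective_iff_map_eq_zero]
    intro v hv
    have hφv : ∀ i, φ i v = 0 := fun i => by rw [← hcoord, hv, map_zero]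
    have hall : ∀ f : V →L[ℂ] ℂ, f v = 0 := by
      intro f
      have := DFunLike.congr_fun (φ.sum_repr f) v
      rw [← this]
      simp [hφv, -Module.Basis.sum_repr]
    refine e.ext_elem fun i => ?_
    simpa [refCoord] using hall (refCoord V i)
  have hdet : LinearMap.det (A : V →ₗ[ℂ] V) ≠ 0 := by
    have := (LinearEquiv.ofInjectiveEndo (A : V →ₗ[ℂ] V) hinj).isUnit_det'
    exact this.ne_zero
  have hw : wedgeFun φ = (wedgeFun (refCoord V)).compContinuousLinearMap (A.restrictScalars ℝ) := by
    ext v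
    rw [ContinuousAlternatingMap.compContinuousLinearMap_apply, wedgeFun_apply, wedgeFun_apply]
    congr 1
    ext i j
    exact (hcoord i (v j)).symm
  have hvol : vol φ = ((Complex.normSq (LinearMap.det (A : V →ₗ[ℂ] V)) : ℝ) : ℂ) • refVol V := by
    have hfr : Module.finrank ℝ V = Module.finrank ℂ V + Module.finrank ℂ V := by
      rw [finrank_real_of_complex, two_mul]
    rw [← det_restrictScalars_complex, ← top_form_comp (Module.finBasisOfFinrankEq ℝ V hfr)]
    have hc : conj (wedgeFun φ) =
        (conj (wedgeFun (refCoord V))).compContinuousLinearMap (A.restrictScalars ℝ) := by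
      rw [hw]
      rfl
    rw [vol, hc, hw, ← wedge_comp]
    rfl
  refine ⟨a * Complex.normSq (LinearMap.det (A : V →ₗ[ℂ] V)),
    mul_pos ha (Complex.normSq_pos.mpr hdet), ?_⟩
  rw [hφ, hvol, smul_smul]
  push_cast
  rfl

end TopForms

/-! ### Holomorphic transition maps and derivatives of charts. -/

section Charts

variable {E : Type*} [NormedAddCommGroup E] [NormedSpace ℂ E]
  {M : Type*} [TopologicalSpace M] [ChartedSpace E M]

/-- The transition map from the preferred chart at `x₀` to the preferred chart at `x₁`. -/
def transition (E : Type*) [NormedAddCommGroup E] [NormedSpace ℂ E]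
    {M : Type*} [TopologicalSpace M] [ChartedSpace E M] (x₀ x₁ : M) : E → E :=
  chartAt E x₁ ∘ (chartAt E x₀).symm

variable [IsManifold 𝓘(ℂ, E) ω M]

theorem contDiffAt_transition {x₀ x₁ : M} {y : E} (hy : y ∈ (chartAt E x₀).target)
    (hy' : (chartAt E x₀).symm y ∈ (chartAt E x₁).source) :
    ContDiffAt ℂ ω (transition E x₀ x₁) y := by
  have h := contDiffOn_ext_coord_change (n := ω) (I := 𝓘(ℂ, E)) x₁ x₀
  have hmem : y ∈ ((chartAt E x₀).symm.trans (chartAt E x₁)).source := by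
    simp [hy, hy']
  have hopen : IsOpen ((chartAt E x₀).symm.trans (chartAt E x₁)).source :=
    ((chartAt E x₀).symm.trans (chartAt E x₁)).open_source
  have hset : ((extChartAt 𝓘(ℂ, E) x₀).symm ≫ extChartAt 𝓘(ℂ, E) x₁).source =
      ((chartAt E x₀).symm.trans (chartAt E x₁)).source := by
    ext z
    simp
  rw [hset] at h
  have h2 := h.contDiffAt (hopen.mem_nhds hmem)
  refine h2.congr_of_eventuallyEq (Filter.Eventually.of_forall fun z => ?_)
  simp [transition]

theorem fderiv_real_transition {x₀ x₁ : M} {y : E} (hy : y ∈ (chartAt E x₀).target)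
    (hy' : (chartAt E x₀).symm y ∈ (chartAt E x₁).source) :
    fderiv ℝ (transition E x₀ x₁) y = (fderiv ℂ (transition E x₀ x₁) y).restrictScalars ℝ :=
  ((contDiffAt_transition hy hy').differentiableAt (by simp)).fderiv_restrictScalars ℝ

theorem chartSymmDeriv_eq_comp_transition {x₀ x₁ : M} {y : E} (hy : y ∈ (chartAt E x₀).target)
    (hy' : (chartAt E x₀).symm y ∈ (chartAt E x₁).source) :
    chartSymmDeriv x₀ y = (chartSymmDeriv x₁ (transition E x₀ x₁ y)).comp
      (fderiv ℂ (transition E x₀ x₁) y) := by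
  have : IsManifold 𝓘(ℂ, E) 1 M := IsManifold.of_le (n := ω) le_top
  have hT : MDifferentiableAt 𝓘(ℂ, E) 𝓘(ℂ, E) (transition E x₀ x₁) y :=
    ((contDiffAt_transition hy hy').differentiableAt (by simp)).mdifferentiableAt
  have hmem : transition E x₀ x₁ y ∈ (chartAt E x₁).target := (chartAt E x₁).map_source hy'
  have hs : MDifferentiableAt 𝓘(ℂ, E) 𝓘(ℂ, E) (chartAt E x₁).symm (transition E x₀ x₁ y) :=
    mdifferentiableAt_atlas_symm (chart_mem_atlas E x₁) hmem
  have h := mfderiv_comp y hs hT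
  rw [mfderiv_eq_fderiv] at h
  refine Eq.trans ?_ h
  refine Filter.EventuallyEq.mfderiv_eq ?_
  have hopen : IsOpen ((chartAt E x₀).symm.trans (chartAt E x₁)).source :=
    ((chartAt E x₀).symm.trans (chartAt E x₁)).open_source
  filter_upwards [hopen.mem_nhds (show y ∈ ((chartAt E x₀).symm.trans (chartAt E x₁)).source by
    simp [hy, hy'])] with z hz
  have hz' : (chartAt E x₀).symm z ∈ (chartAt E x₁).source := by
    simp at hz
    exact hz.2
  exact ((chartAt E x₁).left_inv hz').symm

/-- The preferred chart varies with the point; reading in the chart at `x₀` an object built in the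
chart at the image point therefore costs a transition derivative. -/
theorem chartDeriv_comp_chartSymmDeriv {x₀ : M} {y : E} (hy : y ∈ (chartAt E x₀).target) :
    (chartDeriv ((chartAt E x₀).symm y)).comp (chartSymmDeriv x₀ y) =
      fderiv ℂ (transition E x₀ ((chartAt E x₀).symm y)) y := by
  have : IsManifold 𝓘(ℂ, E) 1 M := IsManifold.of_le (n := ω) le_top
  have h1 : MDifferentiableAt 𝓘(ℂ, E) 𝓘(ℂ, E) (chartAt E x₀).symm y :=
    mdifferentiableAt_atlas_symm (chart_mem_atlas E x₀) hy
  have h2 : MDifferentiableAt 𝓘(ℂ, E) 𝓘(ℂ, E) (chartAt E ((chartAt E x₀).symm y))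
      ((chartAt E x₀).symm y) :=
    mdifferentiableAt_atlas (chart_mem_atlas E _) (mem_chart_source E _)
  have h := mfderiv_comp y h2 h1
  rw [← mfderiv_eq_fderiv]
  exact h.symm

theorem chartSymmDeriv_comp_chartDeriv (x : M) :
    (chartSymmDeriv x (chartAt E x x)).comp (chartDeriv x) = ContinuousLinearMap.id ℂ E := by
  have : IsManifold 𝓘(ℂ, E) 1 M := IsManifold.of_le (n := ω) le_top
  have h1 : MDifferentiableAt 𝓘(ℂ, E) 𝓘(ℂ, E) (chartAt E x).symm (chartAt E x x) :=
    mdifferentiableAt_atlas_symm (chart_mem_atlas E x) (mem_chart_target E x)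
  have h2 : MDifferentiableAt 𝓘(ℂ, E) 𝓘(ℂ, E) (chartAt E x) x :=
    mdifferentiableAt_atlas (chart_mem_atlas E _) (mem_chart_source E _)
  have h := mfderiv_comp x h1 h2
  refine Eq.trans h.symm ?_
  refine Eq.trans (Filter.EventuallyEq.mfderiv_eq ?_) (mfderiv_id (I := 𝓘(ℂ, E)) (x := x))
  filter_upwards [(chartAt E x).open_source.mem_nhds (mem_chart_source E x)] with z hz
  exact (chartAt E x).left_inv hz

end Charts

/-! ### The exterior derivative on the manifold: naturality, smoothness, Leibniz rule. -/

section Forms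

variable {E : Type*} [NormedAddCommGroup E] [NormedSpace ℂ E]
  {M : Type*} [TopologicalSpace M] [ChartedSpace E M] {r s : ℕ}

theorem fromChart_add (x : M) (α β : E [⋀^Fin r]→L[ℝ] ℂ) :
    fromChart x (α + β) = fromChart x α + fromChart x β := rfl

theorem inChart_add (x₀ : M) (θ θ' : Form E M r) :
    inChart x₀ (θ + θ') = inChart x₀ θ + inChart x₀ θ' := rfl

theorem inChart_wedge (x₀ : M) (θ : Form E M r) (θ' : Form E M s) :
    inChart x₀ (fun x => wedge (θ x) (θ' x)) =
      fun y => wedge (inChart x₀ θ y) (inChart x₀ θ' y) :=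
  funext fun _ => wedge_comp _ _ _

theorem inChart_conj (x₀ : M) (θ : Form E M r) :
    inChart x₀ (fun x => conj (θ x)) = fun y => conj (inChart x₀ θ y) := rfl

theorem inChart_eq_zero {x₀ : M} {θ : Form E M r} {y : E} (h : θ ((chartAt E x₀).symm y) = 0) :
    inChart x₀ θ y = 0 := by
  unfold inChart
  rw [h]
  rfl

theorem d_eq_del_add_delbar (θ : Form E M r) : d θ = del θ + delbar θ := by
  funext x
  rw [Pi.add_apply, del, delbar, d, extDeriv, ← fromChart_add,
    ← ContinuousAlternatingMap.alternatizeUncurryFin_add, linearPart_add_antilinearPart]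

theorem IsSmooth.contDiffAt {θ : Form E M r} (hθ : IsSmooth θ) {x₀ : M} {y : E}
    (hy : y ∈ (chartAt E x₀).target) : ContDiffAt ℝ ∞ (inChart x₀ θ) y :=
  (hθ x₀).contDiffAt ((chartAt E x₀).open_target.mem_nhds hy)

theorem IsSmooth.differentiableAt {θ : Form E M r} (hθ : IsSmooth θ) {x₀ : M} {y : E}
    (hy : y ∈ (chartAt E x₀).target) : DifferentiableAt ℝ (inChart x₀ θ) y :=
  (hθ.contDiffAt hy).differentiableAt (by simp)

theorem IsSmooth.differentiableAt_chartAt {θ : Form E M r} (hθ : IsSmooth θ) (x : M) :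
    DifferentiableAt ℝ (inChart x θ) (chartAt E x x) :=
  hθ.differentiableAt (mem_chart_target E x)

theorem IsSmooth.add {θ θ' : Form E M r} (hθ : IsSmooth θ) (hθ' : IsSmooth θ') :
    IsSmooth (θ + θ') := fun _ => (hθ _).add (hθ' _)

theorem isSmooth_zero : IsSmooth (0 : Form E M r) := fun _ =>
  (contDiffOn_const (c := (0 : E [⋀^Fin r]→L[ℝ] ℂ))).congr fun _ _ => inChart_eq_zero rfl

theorem IsSmooth.sum {ι : Type*} {S : Finset ι} {θ : ι → Form E M r}
    (hθ : ∀ i ∈ S, IsSmooth (θ i)) : IsSmooth (∑ i ∈ S, θ i) :=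
  Finset.sum_induction θ IsSmooth (fun _ _ => IsSmooth.add) isSmooth_zero hθ

theorem IsSmooth.conj {θ : Form E M r} (hθ : IsSmooth θ) : IsSmooth fun x => conj (θ x) := by
  intro x₀
  rw [inChart_conj]
  exact (conjL E r).contDiff.comp_contDiffOn (hθ x₀)

theorem IsSmooth.wedge [FiniteDimensional ℂ E] {θ : Form E M r} {θ' : Form E M s}
    (hθ : IsSmooth θ) (hθ' : IsSmooth θ') : IsSmooth fun x => wedge (θ x) (θ' x) := by
  intro x₀
  rw [inChart_wedge]
  exact ((wedgeL E r s).contDiff.comp_contDiffOn (hθ x₀)).clm_apply (hθ' x₀)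

theorem d_add {θ θ' : Form E M r} (hθ : IsSmooth θ) (hθ' : IsSmooth θ') :
    d (θ + θ') = d θ + d θ' := by
  funext x
  rw [Pi.add_apply, d, inChart_add, extDeriv_add (hθ.differentiableAt_chartAt x)
    (hθ'.differentiableAt_chartAt x), fromChart_add]
  rfl

theorem d_zero : d (0 : Form E M r) = 0 := by
  have h := d_add (E := E) (M := M) (r := r) isSmooth_zero isSmooth_zero
  simpa using h

theorem d_sum {ι : Type*} {S : Finset ι} {θ : ι → Form E M r} (hθ : ∀ i ∈ S, IsSmooth (θ i)) :
    d (∑ i ∈ S, θ i) = ∑ i ∈ S, d (θ i) := by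
  classical
  induction S using Finset.induction_on with
  | empty => simpa using d_zero
  | insert i S hi ih =>
    have hS : ∀ j ∈ S, IsSmooth (θ j) := fun j hj => hθ j (Finset.mem_insert_of_mem hj)
    rw [Finset.sum_insert hi, Finset.sum_insert hi,
      d_add (hθ i (Finset.mem_insert_self i S)) (IsSmooth.sum hS), ih hS]

theorem d_conj (θ : Form E M r) (hθ : IsSmooth θ) :
    d (fun x => conj (θ x)) = fun x => conj (d θ x) := by
  funext x
  have h : fderiv ℝ (inChart x fun x => conj (θ x)) (chartAt E x x) =
      (conjL E r).comp (fderiv ℝ (inChart x θ) (chartAt E x x)) :=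
    ((conjL E r).hasFDerivAt.comp _ (hθ.differentiableAt_chartAt x).hasFDerivAt).fderiv
  rw [d, extDeriv, h, altUncurry_conj]
  rfl

variable [IsManifold 𝓘(ℂ, E) ω M]

theorem fromChart_inChart (x : M) (θ : Form E M r) :
    fromChart x (inChart x θ (chartAt E x x)) = θ x := by
  have h := chartSymmDeriv_comp_chartDeriv (E := E) x
  have h' : ∀ v, chartSymmDeriv x (chartAt E x x) (chartDeriv x v) = v := fun v =>
    DFunLike.congr_fun h v
  have hx : (chartAt E x).symm (chartAt E x x) = x := (chartAt E x).left_inv (mem_chart_source E x)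
  ext v
  change θ ((chartAt E x).symm (chartAt E x x))
    (fun i => chartSymmDeriv x (chartAt E x x) (chartDeriv x (v i))) = θ x v
  simp only [h', hx]

theorem inChart_eq_transition (θ : Form E M r) {x₀ x₁ : M} {y : E}
    (hy : y ∈ (chartAt E x₀).target)
    (hy' : (chartAt E x₀).symm y ∈ (chartAt E x₁).source) :
    inChart x₀ θ y = (inChart x₁ θ (transition E x₀ x₁ y)).compContinuousLinearMap
      (fderiv ℝ (transition E x₀ x₁) y) := by
  have hx : (chartAt E x₁).symm (transition E x₀ x₁ y) = (chartAt E x₀).symm y :=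
    (chartAt E x₁).left_inv hy'
  rw [fderiv_real_transition hy hy']
  unfold inChart
  rw [hx, chartSymmDeriv_eq_comp_transition hy hy']
  rfl

/-- `d` is defined at each point through that point's own chart. Naturality of `extDeriv` under the
transition map shows that it is the Euclidean exterior derivative in any fixed preferred chart. -/
theorem inChart_d {θ : Form E M r} (hθ : IsSmooth θ) {x₀ : M} {y : E}
    (hy : y ∈ (chartAt E x₀).target) : inChart x₀ (d θ) y = extDeriv (inChart x₀ θ) y := by
  set x := (chartAt E x₀).symm y with hx
  have hys : (chartAt E x₀).symm y ∈ (chartAt E x).source := mem_chart_source E x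
  have hTy : transition E x₀ x y = chartAt E x x := rfl
  have h1 : inChart x₀ (d θ) y =
      (extDeriv (inChart x θ) (transition E x₀ x y)).compContinuousLinearMap
        (fderiv ℝ (transition E x₀ x) y) := by
    rw [fderiv_real_transition hy hys, ← chartDeriv_comp_chartSymmDeriv hy]
    rfl
  rw [h1, ← extDeriv_pullback (r := ω)
    (by rw [hTy]; exact hθ.differentiableAt_chartAt x)
    ((contDiffAt_transition hy hys).restrict_scalars ℝ) le_top]
  refine Filter.EventuallyEq.extDeriv_eq ?_
  have hopen : IsOpen ((chartAt E x₀).symm.trans (chartAt E x)).source :=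
    ((chartAt E x₀).symm.trans (chartAt E x)).open_source
  filter_upwards [hopen.mem_nhds (show y ∈ ((chartAt E x₀).symm.trans (chartAt E x)).source by
    simp [hy, hys])] with z hz
  simp at hz
  exact (inChart_eq_transition θ hz.1 hz.2).symm

theorem contDiffOn_extDeriv {f : E → E [⋀^Fin r]→L[ℝ] ℂ} {U : Set E} (hU : IsOpen U)
    (hf : ContDiffOn ℝ ∞ f U) : ContDiffOn ℝ ∞ (extDeriv f) U :=
  (ContinuousAlternatingMap.alternatizeUncurryFinCLM ℝ E ℂ).contDiff.comp_contDiffOn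
    (hf.fderiv_of_isOpen hU (by simp))

theorem IsSmooth.d {θ : Form E M r} (hθ : IsSmooth θ) : IsSmooth (d θ) := fun x₀ =>
  (contDiffOn_extDeriv (chartAt E x₀).open_target (hθ x₀)).congr fun _ hy => inChart_d hθ hy

theorem d_wedge_of_closed [FiniteDimensional ℂ E] {θ : Form E M r} {ξ : Form E M s}
    (hθ : IsSmooth θ) (hξ : IsSmooth ξ) (hdξ : PKahler.d ξ = 0) (x : M) :
    PKahler.d (fun x => PKahler.wedge (θ x) (ξ x)) x =
      PKahler.castDeg (by omega) (PKahler.wedge (PKahler.d θ x) (ξ x)) := by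
  have hclosed : ContinuousAlternatingMap.alternatizeUncurryFin
      (fderiv ℝ (inChart x ξ) (chartAt E x x)) = 0 := by
    have h := inChart_d hξ (mem_chart_target E x)
    rw [hdξ] at h
    exact h.symm.trans (inChart_eq_zero rfl)
  have hder : fderiv ℝ (fun y => PKahler.wedge (inChart x θ y) (inChart x ξ y)) (chartAt E x x) =
      (wedgeL E r s (inChart x θ (chartAt E x x))).comp (fderiv ℝ (inChart x ξ) (chartAt E x x)) +
      ((wedgeL E r s).flip (inChart x ξ (chartAt E x x))).comp
        (fderiv ℝ (inChart x θ) (chartAt E x x)) :=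
    (wedgeL E r s).fderiv_of_bilinear (hθ.differentiableAt_chartAt x)
      (hξ.differentiableAt_chartAt x)
  have hdeg : r + 1 + s = r + s + 1 := by omega
  have hcast : ∀ α : E [⋀^Fin (r + 1 + s)]→L[ℝ] ℂ, fromChart x (PKahler.castDeg hdeg α) =
      PKahler.castDeg hdeg (fromChart x α) := fun _ => rfl
  rw [PKahler.d, extDeriv, inChart_wedge, hder,
    ContinuousAlternatingMap.alternatizeUncurryFin_add, altUncurry_wedge_right _ _ hclosed,
    zero_add, altUncurry_wedge_left, hcast]
  unfold fromChart
  rw [wedge_comp]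
  congr 2
  exact fromChart_inChart x ξ

end Forms

/-! ### The effect of `∂` and `\bar∂` on weights. -/

section Types

variable {E : Type*} [NormedAddCommGroup E] [NormedSpace ℂ E]
  {M : Type*} [TopologicalSpace M] [ChartedSpace E M] {r : ℕ}

/-- Chart derivatives are complex-linear, so in a chart the weight condition is a
constant-coefficient linear equation `Λ = 0`, which may be differentiated. -/
theorem hasWeight_fderiv_inChart {c : ℂ} {θ : Form E M r} (hθ : IsSmooth θ)
    (hw : ∀ x, HasWeight c (θ x)) (x : M) (v : E) :
    HasWeight c (fderiv ℝ (inChart x θ) (chartAt E x x) v) := by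
  let Λ : (E [⋀^Fin r]→L[ℝ] ℂ) →L[ℝ] (E [⋀^Fin r]→L[ℝ] ℂ) :=
    ContinuousAlternatingMap.compContinuousLinearMapCLM (J E) - c • ContinuousLinearMap.id ℝ _
  have hΛ : ∀ α, Λ α = α.compContinuousLinearMap (J E) - c • α := fun _ => rfl
  have h0 : (fun y => Λ (inChart x θ y)) = fun _ => 0 := by
    funext y
    rw [hΛ, sub_eq_zero]
    exact (hw _).comp (chartSymmDeriv x y)
  have h1 : fderiv ℝ (fun y => Λ (inChart x θ y)) (chartAt E x x) =
      Λ.comp (fderiv ℝ (inChart x θ) (chartAt E x x)) :=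
    (Λ.hasFDerivAt.comp _ (hθ.differentiableAt_chartAt x).hasFDerivAt).fderiv
  rw [h0] at h1
  have h2 := DFunLike.congr_fun h1 v
  simp only [fderiv_fun_const, Pi.zero_apply] at h2
  exact sub_eq_zero.mp h2.symm

theorem hasWeight_del {c : ℂ} {θ : Form E M r} (hθ : IsSmooth θ)
    (hw : ∀ x, HasWeight c (θ x)) (x : M) : HasWeight (Complex.I * c) (del θ x) :=
  (hasWeight_altUncurry_linearPart (hasWeight_fderiv_inChart hθ hw x)).comp (chartDeriv x)

theorem hasWeight_delbar {c : ℂ} {θ : Form E M r} (hθ : IsSmooth θ)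
    (hw : ∀ x, HasWeight c (θ x)) (x : M) : HasWeight (-Complex.I * c) (delbar θ x) :=
  (hasWeight_altUncurry_antilinearPart (hasWeight_fderiv_inChart hθ hw x)).comp (chartDeriv x)

/-- On forms of weight `1` the operator `\bar ∂` preserves smoothness, being a projection
of `d`. -/
theorem IsSmooth.delbar [IsManifold 𝓘(ℂ, E) ω M] {θ : Form E M r} (hθ : IsSmooth θ)
    (hw : ∀ x, HasWeight 1 (θ x)) : IsSmooth (delbar θ) := by
  -- On weight `c` this is multiplication by `(1 + ic)/2`: it kills `∂θ`, of weight `i`, and fixes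
  -- `\bar∂θ`, of weight `-i`.
  let Λ : (E [⋀^Fin r.succ]→L[ℝ] ℂ) →L[ℝ] (E [⋀^Fin r.succ]→L[ℝ] ℂ) :=
    (1 / 2 : ℂ) • (ContinuousLinearMap.id ℝ _ +
      Complex.I • ContinuousAlternatingMap.compContinuousLinearMapCLM (J E))
  have hΛ : ∀ α v, Λ α v = (1 / 2 : ℂ) * (α v + Complex.I * α (fun i => Complex.I • v i)) :=
    fun _ _ => rfl
  have h : ∀ x, PKahler.delbar θ x = Λ (PKahler.d θ x) := by
    intro x
    ext v
    have h1 := hasWeight_iff.mp (hasWeight_del hθ hw x) v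
    have h2 := hasWeight_iff.mp (hasWeight_delbar hθ hw x) v
    rw [hΛ, d_eq_del_add_delbar, Pi.add_apply, ContinuousAlternatingMap.add_apply,
      ContinuousAlternatingMap.add_apply, h1, h2]
    linear_combination (-1 / 2 * (PKahler.del θ x v - PKahler.delbar θ x v)) * Complex.I_mul_I
  intro x₀
  have hchart : inChart x₀ (PKahler.delbar θ) = fun y => Λ (inChart x₀ (PKahler.d θ) y) := by
    funext y
    ext v
    rw [hΛ]
    unfold inChart
    rw [h]
    simp only [ContinuousAlternatingMap.compContinuousLinearMap_apply]
    rw [hΛ]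
    congr 3
    simp only [Function.comp_def, ContinuousLinearMap.coe_restrictScalars', map_smul]
  rw [hchart]
  exact Λ.contDiff.comp_contDiffOn (hθ.d x₀)

end Types

end PKahler

namespace PKahler

open MeasureTheory Set

/-! ### Stokes' theorem for compactly supported forms on a vector space. -/

section Euclidean

variable {E : Type*} [NormedAddCommGroup E] [NormedSpace ℝ E] [FiniteDimensional ℝ E]
  [MeasurableSpace E] [BorelSpace E] (μ : Measure E) [μ.IsAddHaarMeasure]

/-- Integration by parts against the constant function `1`. -/
theorem integral_fderiv_eq_zero {g : E → ℂ} (hg : ContDiff ℝ ∞ g) (hc : HasCompactSupport g)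
    (v : E) : ∫ y, fderiv ℝ g y v ∂μ = 0 := by
  have hd : Continuous fun y => fderiv ℝ g y v :=
    (hg.continuous_fderiv (by simp)).clm_apply continuous_const
  have hdc : HasCompactSupport fun y => fderiv ℝ g y v :=
    (hc.fderiv ℝ).comp_left (g := fun L : E →L[ℝ] ℂ => L v) rfl
  have h := integral_smul_fderiv_eq_neg_fderiv_smul_of_integrable (μ := μ) (𝕜 := ℝ)
    (f := fun _ : E => (1 : ℝ)) (g := g) (v := v) (by simp)
    (by simpa using hd.integrable_of_hasCompactSupport hdc)
    (by simpa using hg.continuous.integrable_of_hasCompactSupport hc)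
    (fun _ _ => differentiableAt_const _)
    (fun x _ => hg.contDiffAt.differentiableAt (by simp))
  simpa using h

theorem integral_extDeriv_eq_zero {m : ℕ} {f : E → E [⋀^Fin m]→L[ℝ] ℂ} (hf : ContDiff ℝ ∞ f)
    (hc : HasCompactSupport f) (v : Fin (m + 1) → E) : ∫ y, extDeriv f y v ∂μ = 0 := by
  have hfun : ∀ i : Fin (m + 1), ContDiff ℝ ∞ fun y => f y (i.removeNth v) := fun i =>
    (ContinuousAlternatingMap.apply ℝ E ℂ (i.removeNth v)).contDiff.comp hf
  have hcs : ∀ i : Fin (m + 1), HasCompactSupport fun y => f y (i.removeNth v) := fun i =>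
    hc.comp_left (g := fun α : E [⋀^Fin m]→L[ℝ] ℂ => α (i.removeNth v)) rfl
  have h1 : ∀ y, extDeriv f y v =
      ∑ i : Fin (m + 1), (-1) ^ (i : ℕ) * fderiv ℝ (fun y => f y (i.removeNth v)) y (v i) := by
    intro y
    rw [extDeriv_apply (hf.contDiffAt.differentiableAt (by simp)) v]
    simp
  simp only [h1]
  rw [integral_finsetSum]
  · refine Finset.sum_eq_zero fun i _ => ?_
    rw [integral_const_mul, integral_fderiv_eq_zero μ (hfun i) (hcs i), mul_zero]
  · intro i _
    refine Integrable.const_mul ?_ _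
    refine Continuous.integrable_of_hasCompactSupport
      (((hfun i).continuous_fderiv (by simp)).clm_apply continuous_const) ?_
    exact ((hcs i).fderiv ℝ).comp_left (g := fun L : E →L[ℝ] ℂ => L (v i)) rfl

end Euclidean

/-! ### Finite smooth partitions of unity subordinate to chart domains. -/

section PartitionOfUnity

variable (E : Type*) [NormedAddCommGroup E] [NormedSpace ℂ E]
  (M : Type*) [TopologicalSpace M] [ChartedSpace E M] [IsManifold 𝓘(ℂ, E) ω M]

theorem isManifold_real : IsManifold 𝓘(ℝ, E) ∞ M := by
  refine isManifold_of_contDiffOn _ _ _ fun e e' he he' => ?_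
  have h : e.symm.trans e' ∈ contDiffGroupoid ω 𝓘(ℂ, E) := HasGroupoid.compatible he he'
  rw [contDiffGroupoid, mem_groupoid_of_pregroupoid] at h
  have h1 := h.1
  simp only [contDiffPregroupoid] at h1
  exact (h1.restrict_scalars ℝ).of_le le_top

variable [FiniteDimensional ℂ E] [CompactSpace M] [T2Space M]

/-- The partition lives on the underlying real manifold. Local finiteness and compactness leave
finitely many nonzero members, so all later sums are finite. -/
theorem exists_partitionOfUnity : ∃ (S : Finset M) (ρ : M → M → ℝ), (∀ i x, 0 ≤ ρ i x) ∧
    (∀ x, ∑ i ∈ S, ρ i x = 1) ∧ (∀ i, tsupport (ρ i) ⊆ (chartAt E i).source) ∧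
    ∀ i x₀, ContDiffOn ℝ ∞ (fun y => ρ i ((chartAt E x₀).symm y)) (chartAt E x₀).target := by
  have := isManifold_real E M
  have : FiniteDimensional ℝ E := FiniteDimensional.complexToReal E
  obtain ⟨f, hf⟩ := SmoothPartitionOfUnity.exists_isSubordinate_chartAt_source 𝓘(ℝ, E) M
  have hfin := f.locallyFinite.finite_nonempty_of_compact
  refine ⟨hfin.toFinset, fun i => f i, fun i x => f.nonneg i x, fun x => ?_, hf, fun i x₀ => ?_⟩
  · rw [← f.sum_eq_one (mem_univ x)]
    refine (finsum_eq_sum_of_support_subset _ ?_).symm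
    intro i hi
    simp only [Finite.coe_toFinset, mem_ofPred_eq]
    exact ⟨x, hi⟩
  · have h1 : ContMDiffOn 𝓘(ℝ, E) 𝓘(ℝ, ℝ) ∞ (f i ∘ (chartAt E x₀).symm) (chartAt E x₀).target :=
      (f i).contMDiff.comp_contMDiffOn contMDiffOn_chart_symm
    exact contMDiffOn_iff_contDiffOn.mp h1

end PartitionOfUnity

/-! ### Integration over charts, Stokes on a compact complex manifold, and positivity. -/

section Stokes

variable {E : Type*} [NormedAddCommGroup E] [NormedSpace ℂ E]
  {M : Type*} [TopologicalSpace M] [ChartedSpace E M] {r : ℕ}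

theorem inChart_smul (x₀ : M) (ρ : M → ℝ) (θ : Form E M r) :
    inChart x₀ (fun x => ρ x • θ x) = fun y => ρ ((chartAt E x₀).symm y) • inChart x₀ θ y := rfl

theorem inChart_sum {ι : Type*} (S : Finset ι) (x₀ : M) (θ : ι → Form E M r) (y : E)
    (v : Fin r → E) : inChart x₀ (∑ i ∈ S, θ i) y v = ∑ i ∈ S, inChart x₀ (θ i) y v := by
  classical
  induction S using Finset.induction_on with
  | empty => rfl
  | insert i S hi ih =>
    rw [Finset.sum_insert hi, Finset.sum_insert hi, inChart_add, Pi.add_apply,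
      ContinuousAlternatingMap.add_apply, ih]

theorem IsSmooth.fun_smul {ρ : M → ℝ} {θ : Form E M r}
    (hρ : ∀ x₀, ContDiffOn ℝ ∞ (fun y => ρ ((chartAt E x₀).symm y)) (chartAt E x₀).target)
    (hθ : IsSmooth θ) : IsSmooth fun x => ρ x • θ x := by
  intro x₀
  rw [inChart_smul]
  exact (hρ x₀).smul (hθ x₀)

theorem d_eq_zero_of_eventuallyEq {θ : Form E M r} {x : M} (h : ∀ᶠ x' in nhds x, θ x' = 0) :
    d θ x = 0 := by
  have hx : (chartAt E x).symm (chartAt E x x) = x := (chartAt E x).left_inv (mem_chart_source E x)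
  have hcont : Filter.Tendsto (chartAt E x).symm (nhds (chartAt E x x)) (nhds x) := by
    have := (chartAt E x).symm.continuousAt (mem_chart_target E x)
    rwa [ContinuousAt, hx] at this
  have h0 : inChart x θ =ᶠ[nhds (chartAt E x x)] fun _ => 0 := by
    filter_upwards [hcont.eventually h] with y hy
    exact inChart_eq_zero hy
  rw [d, h0.extDeriv_eq, extDeriv, fderiv_const_apply]
  exact congrArg (fromChart x) (map_zero (ContinuousAlternatingMap.alternatizeUncurryFinCLM ℝ E ℂ))

theorem form_zero_smul {V : Type*} [NormedAddCommGroup V] [NormedSpace ℂ V]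
    (α : V [⋀^Fin r]→L[ℝ] ℂ) : (0 : ℝ) • α = 0 := zero_smul ℝ α

theorem form_smul_zero {V : Type*} [NormedAddCommGroup V] [NormedSpace ℂ V] (c : ℝ) :
    c • (0 : V [⋀^Fin r]→L[ℝ] ℂ) = 0 := by
  ext v
  exact smul_zero c

variable [FiniteDimensional ℂ E] [MeasurableSpace E] [BorelSpace E]
  (μ : Measure E) [μ.IsAddHaarMeasure]

/-- The integral of a form over the domain of a chart, relative to the tuple `v`. -/
def chartIntegral (v : Fin r → E) (x₀ : M) (θ : Form E M r) : ℂ :=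
  ∫ y in (chartAt E x₀).target, inChart x₀ θ y v ∂μ

omit [FiniteDimensional ℂ E] in
theorem integrableOn_inChart (v : Fin r → E) {x₀ : M} {θ : Form E M r} (hθ : IsSmooth θ)
    {K : Set M} (hK : IsCompact K) (hKs : K ⊆ (chartAt E x₀).source) (h0 : ∀ x ∉ K, θ x = 0) :
    IntegrableOn (fun y => inChart x₀ θ y v) (chartAt E x₀).target μ := by
  have hcont : ContinuousOn (fun y => inChart x₀ θ y v) (chartAt E x₀).target :=
    (ContinuousAlternatingMap.apply ℝ E ℂ v).continuous.comp_continuousOn (hθ x₀).continuousOn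
  have hK' : IsCompact (chartAt E x₀ '' K) :=
    hK.image_of_continuousOn ((chartAt E x₀).continuousOn.mono hKs)
  have hsub : chartAt E x₀ '' K ⊆ (chartAt E x₀).target := by
    rintro _ ⟨x, hx, rfl⟩
    exact (chartAt E x₀).map_source (hKs hx)
  refine ((hcont.mono hsub).integrableOn_compact hK').of_forall_sdiff_eq_zero
    (chartAt E x₀).open_target.measurableSet fun y hy => ?_
  rw [inChart_eq_zero]
  · rfl
  · refine h0 _ fun hmem => hy.2 ⟨_, hmem, (chartAt E x₀).right_inv hy.1⟩

theorem chartIntegral_d_eq_zero [IsManifold 𝓘(ℂ, E) ω M] (v : Fin (r + 1) → E) {x₀ : M}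
    {θ : Form E M r} (hθ : IsSmooth θ) {K : Set M} (hK : IsCompact K)
    (hKs : K ⊆ (chartAt E x₀).source) (h0 : ∀ x ∉ K, θ x = 0) :
    chartIntegral μ v x₀ (d θ) = 0 := by
  have : FiniteDimensional ℝ E := FiniteDimensional.complexToReal E
  have hK' : IsCompact (chartAt E x₀ '' K) :=
    hK.image_of_continuousOn ((chartAt E x₀).continuousOn.mono hKs)
  have hsub : chartAt E x₀ '' K ⊆ (chartAt E x₀).target := by
    rintro _ ⟨x, hx, rfl⟩
    exact (chartAt E x₀).map_source (hKs hx)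
  -- Extension by zero stays smooth, since the support lies in a compact subset of the chart target.
  let f : E → E [⋀^Fin r]→L[ℝ] ℂ := (chartAt E x₀).target.indicator (inChart x₀ θ)
  have hf0 : ∀ y ∉ chartAt E x₀ '' K, f y = 0 := by
    intro y hy
    by_cases hyt : y ∈ (chartAt E x₀).target
    · rw [show f y = inChart x₀ θ y from indicator_of_mem hyt _]
      exact inChart_eq_zero (h0 _ fun hmem => hy ⟨_, hmem, (chartAt E x₀).right_inv hyt⟩)
    · exact indicator_of_notMem hyt _
  have hfin : ∀ y ∈ (chartAt E x₀).target, f =ᶠ[nhds y] inChart x₀ θ := by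
    intro y hy
    filter_upwards [(chartAt E x₀).open_target.mem_nhds hy] with z hz
    exact indicator_of_mem hz _
  have hfout : ∀ y ∉ (chartAt E x₀).target, f =ᶠ[nhds y] fun _ => 0 := by
    intro y hy
    filter_upwards [hK'.isClosed.isOpen_compl.mem_nhds fun h => hy (hsub h)] with z hz
    exact hf0 z hz
  have hf : ContDiff ℝ ∞ f := by
    rw [contDiff_iff_contDiffAt]
    intro y
    by_cases hy : y ∈ (chartAt E x₀).target
    · exact (hθ.contDiffAt hy).congr_of_eventuallyEq (hfin y hy)
    · exact contDiffAt_const.congr_of_eventuallyEq (hfout y hy)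
  have hfc : HasCompactSupport f := HasCompactSupport.intro hK' hf0
  have hext : ∫ y in (chartAt E x₀).target, extDeriv f y v ∂μ = ∫ y, extDeriv f y v ∂μ := by
    refine setIntegral_eq_integral_of_forall_compl_eq_zero fun y hy => ?_
    rw [(hfout y hy).extDeriv_eq, extDeriv, fderiv_const_apply]
    exact congrArg (fun α : E [⋀^Fin (r + 1)]→L[ℝ] ℂ => α v)
      (map_zero (ContinuousAlternatingMap.alternatizeUncurryFinCLM ℝ E ℂ))
  rw [← integral_extDeriv_eq_zero μ hf hfc v, chartIntegral, ← hext]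
  refine setIntegral_congr_fun (chartAt E x₀).open_target.measurableSet fun y hy => ?_
  rw [inChart_d hθ hy, (hfin y hy).extDeriv_eq]

omit [MeasurableSpace E] [BorelSpace E] in
theorem inChart_top_transition [IsManifold 𝓘(ℂ, E) ω M] (b : Module.Basis (Fin r) ℝ E)
    (θ : Form E M r) {x₀ x₁ : M} {y : E} (hy : y ∈ (chartAt E x₀).target)
    (hy' : (chartAt E x₀).symm y ∈ (chartAt E x₁).source) :
    inChart x₀ θ y b = |(fderiv ℝ (transition E x₀ x₁) y).det| •
      inChart x₁ θ (transition E x₀ x₁ y) b := by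
  rw [inChart_eq_transition θ hy hy', top_form_comp b, fderiv_real_transition hy hy',
    ContinuousLinearMap.det, det_restrictScalars_complex, abs_of_nonneg (Complex.normSq_nonneg _)]
  exact Complex.coe_smul _ _

/-- The integral of a top-degree form supported in two chart domains does not depend on the chart,
because holomorphic maps preserve orientation. -/
theorem chartIntegral_eq [IsManifold 𝓘(ℂ, E) ω M] (b : Module.Basis (Fin r) ℝ E)
    (θ : Form E M r) {x₀ x₁ : M}
    (h0 : ∀ x, x ∉ (chartAt E x₀).source ∩ (chartAt E x₁).source → θ x = 0) :
    chartIntegral μ b x₀ θ = chartIntegral μ b x₁ θ := by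
  have : FiniteDimensional ℝ E := FiniteDimensional.complexToReal E
  let e := (chartAt E x₀).symm.trans (chartAt E x₁)
  have hes : ∀ y, y ∈ e.source ↔ y ∈ (chartAt E x₀).target ∧
      (chartAt E x₀).symm y ∈ (chartAt E x₁).source := fun y => by simp [e]
  have het : ∀ y, y ∈ e.target ↔ y ∈ (chartAt E x₁).target ∧
      (chartAt E x₁).symm y ∈ (chartAt E x₀).source := fun y => by simp [e]
  have h1 : chartIntegral μ b x₀ θ = ∫ y in e.source, inChart x₀ θ y b ∂μ := by
    refine setIntegral_eq_of_subset_of_forall_sdiff_eq_zero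
      (chartAt E x₀).open_target.measurableSet (fun y hy => ((hes y).mp hy).1) fun y hy => ?_
    rw [inChart_eq_zero]
    · rfl
    · exact h0 _ fun h => hy.2 ((hes y).mpr ⟨hy.1, h.2⟩)
  have h2 : chartIntegral μ b x₁ θ = ∫ y in e.target, inChart x₁ θ y b ∂μ := by
    refine setIntegral_eq_of_subset_of_forall_sdiff_eq_zero
      (chartAt E x₁).open_target.measurableSet (fun y hy => ((het y).mp hy).1) fun y hy => ?_
    rw [inChart_eq_zero]
    · rfl
    · exact h0 _ fun h => hy.2 ((het y).mpr ⟨hy.1, h.1⟩)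
  rw [h1, h2, ← e.image_source_eq_target,
    integral_image_eq_integral_abs_det_fderiv_smul μ e.open_source.measurableSet
      (f' := fun y => fderiv ℝ (transition E x₀ x₁) y) ?_ e.injOn]
  · refine setIntegral_congr_fun e.open_source.measurableSet fun y hy => ?_
    exact inChart_top_transition b θ ((hes y).mp hy).1 ((hes y).mp hy).2
  · intro y hy
    have hT := contDiffAt_transition ((hes y).mp hy).1 ((hes y).mp hy).2
    exact ((hT.restrict_scalars ℝ).differentiableAt (by simp)).hasFDerivAt.hasFDerivWithinAt

variable [IsManifold 𝓘(ℂ, E) ω M] [CompactSpace M]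

omit [FiniteDimensional ℂ E] [IsManifold 𝓘(ℂ, E) ω M] [CompactSpace M] in
theorem chartIntegral_sum (v : Fin r → E) {x₀ : M} {ι : Type*} (S : Finset ι)
    {θ : ι → Form E M r} (hθ : ∀ i ∈ S, IsSmooth (θ i)) {K : Set M} (hK : IsCompact K)
    (hKs : K ⊆ (chartAt E x₀).source) (h0 : ∀ i ∈ S, ∀ x ∉ K, θ i x = 0) :
    chartIntegral μ v x₀ (∑ i ∈ S, θ i) = ∑ i ∈ S, chartIntegral μ v x₀ (θ i) := by
  unfold chartIntegral
  simp only [inChart_sum]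
  exact integral_finsetSum S fun i hi => integrableOn_inChart μ v (hθ i hi) hK hKs (h0 i hi)

/-- Stokes' theorem on a compact complex manifold, with the integral expressed through a
partition of unity. -/
theorem sum_chartIntegral_d_eq_zero (b : Module.Basis (Fin (r + 1)) ℝ E) {η : Form E M r}
    (hη : IsSmooth η) {S : Finset M} {ρ : M → M → ℝ} (hsum : ∀ x, ∑ i ∈ S, ρ i x = 1)
    (hsupp : ∀ i, tsupport (ρ i) ⊆ (chartAt E i).source)
    (hsmooth : ∀ i x₀, ContDiffOn ℝ ∞ (fun y => ρ i ((chartAt E x₀).symm y))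
      (chartAt E x₀).target) :
    ∑ j ∈ S, chartIntegral μ b j (fun x => ρ j x • d η x) = 0 := by
  have hcpt : ∀ i, IsCompact (tsupport (ρ i)) := fun i => (isClosed_tsupport _).isCompact
  have hρ0 : ∀ i x, x ∉ tsupport (ρ i) → ρ i x = 0 := fun i x hx =>
    image_eq_zero_of_notMem_tsupport hx
  have hsplit : ∀ {k : ℕ} (θ : Form E M k), θ = ∑ j ∈ S, fun x => ρ j x • θ x := by
    intro k θ
    funext x
    rw [Finset.sum_apply, ← Finset.sum_smul, hsum, one_smul]
  let η' : M → Form E M r := fun i x => ρ i x • η x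
  have hη' : ∀ i, IsSmooth (η' i) := fun i => hη.fun_smul (hsmooth i)
  have hη0 : ∀ i, ∀ x ∉ tsupport (ρ i), η' i x = 0 := fun i x hx => by
    simp only [η', hρ0 i x hx, form_zero_smul]
  have hdη0 : ∀ i, ∀ x ∉ tsupport (ρ i), d (η' i) x = 0 := by
    intro i x hx
    apply d_eq_zero_of_eventuallyEq
    filter_upwards [(isClosed_tsupport (ρ i)).isOpen_compl.mem_nhds hx] with z hz
    exact hη0 i z hz
  have hdη : d η = ∑ i ∈ S, d (η' i) := by
    rw [← d_sum fun i _ => hη' i, ← hsplit η]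
  calc ∑ j ∈ S, chartIntegral μ b j (fun x => ρ j x • d η x)
      = ∑ j ∈ S, ∑ i ∈ S, chartIntegral μ b j (fun x => ρ j x • d (η' i) x) := by
        refine Finset.sum_congr rfl fun j _ => ?_
        have h : (fun x => ρ j x • d η x) = ∑ i ∈ S, fun x => ρ j x • d (η' i) x := by
          funext x
          rw [hdη, Finset.sum_apply, Finset.sum_apply, Finset.smul_sum]
        rw [h]
        refine chartIntegral_sum μ b S (fun i _ => (hη' i).d.fun_smul (hsmooth j)) (hcpt j)
          (hsupp j) fun i _ x hx => ?_
        simp only [hρ0 j x hx, form_zero_smul]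
    -- The form `ρ_j d(ρ_i η)` is supported in both chart domains, so its integral can be moved from
    -- chart `j` to chart `i`. Summing over `j` then removes `ρ_j` and leaves an exact form with
    -- compact support in chart `i`.
    _ = ∑ j ∈ S, ∑ i ∈ S, chartIntegral μ b i (fun x => ρ j x • d (η' i) x) := by
        refine Finset.sum_congr rfl fun j _ => Finset.sum_congr rfl fun i _ => ?_
        refine chartIntegral_eq μ b _ fun x hx => ?_
        by_cases hj : x ∈ tsupport (ρ j)
        · have hi : x ∉ tsupport (ρ i) := fun hi => hx ⟨hsupp j hj, hsupp i hi⟩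
          simp only [hdη0 i x hi, form_smul_zero]
        · simp only [hρ0 j x hj, form_zero_smul]
    _ = ∑ i ∈ S, ∑ j ∈ S, chartIntegral μ b i (fun x => ρ j x • d (η' i) x) := Finset.sum_comm
    _ = ∑ i ∈ S, chartIntegral μ b i (d (η' i)) := by
        refine Finset.sum_congr rfl fun i _ => ?_
        conv_rhs => rw [hsplit (d (η' i))]
        refine (chartIntegral_sum μ b S (fun j _ => (hη' i).d.fun_smul (hsmooth j)) (hcpt i)
          (hsupp i) fun j _ x hx => ?_).symm
        simp only [hdη0 i x hx, form_smul_zero]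
    _ = 0 := Finset.sum_eq_zero fun i _ =>
        chartIntegral_d_eq_zero μ b (hη' i) (hcpt i) (hsupp i) (hη0 i)

omit [MeasurableSpace E] [BorelSpace E] in
/-- On a compact complex manifold an exact top-degree form that is pointwise a nonnegative multiple
of a fixed volume form vanishes. -/
theorem d_eq_zero_of_nonneg [T2Space M] {η : Form E M r} (hη : IsSmooth η)
    (hr : Module.finrank ℝ E = r + 1) {ν : E [⋀^Fin (r + 1)]→L[ℝ] ℂ} (hν : ν ≠ 0) {a : M → ℝ}
    (ha : ∀ x, 0 ≤ a x) (hd : ∀ x, d η x = (a x : ℂ) • ν) : d η = 0 := by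
  have : FiniteDimensional ℝ E := FiniteDimensional.complexToReal E
  let _ : MeasurableSpace E := borel E
  have : BorelSpace E := ⟨rfl⟩
  let b := Module.finBasisOfFinrankEq ℝ E hr
  let μ : Measure E := b.addHaar
  obtain ⟨S, ρ, hρ, hsum, hsupp, hsmooth⟩ := exists_partitionOfUnity E M
  have hνb : ν b ≠ 0 := fun h => hν (by ext v; rw [top_form_apply b, h, mul_zero]; rfl)
  have hcpt : ∀ i, IsCompact (tsupport (ρ i)) := fun i => (isClosed_tsupport _).isCompact
  let τ : M → Form E M (r + 1) := fun j x => ρ j x • d η x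
  have hτ : ∀ j, IsSmooth (τ j) := fun j => hη.d.fun_smul (hsmooth j)
  let D : M → E → ℝ := fun j y =>
    Complex.normSq (LinearMap.det (chartSymmDeriv j y : E →ₗ[ℂ] E))
  -- `g j` is the coefficient of `ρ_j dη` in chart `j` relative to `ν`; the Jacobian factor `D` is
  -- `|det|²`, so the sign of `a` survives.
  let g : M → E → ℝ := fun j y =>
    ρ j ((chartAt E j).symm y) * a ((chartAt E j).symm y) * D j y
  have hg0 : ∀ j y, 0 ≤ g j y := fun j y =>
    mul_nonneg (mul_nonneg (hρ _ _) (ha _)) (Complex.normSq_nonneg _)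
  have hτg : ∀ j y, inChart j (τ j) y b = (g j y : ℂ) * ν b := by
    intro j y
    have h1 : inChart j (τ j) y b = (ρ j ((chartAt E j).symm y) : ℂ) *
        ((a ((chartAt E j).symm y) : ℂ) * (ν.compContinuousLinearMap
          ((chartSymmDeriv j y).restrictScalars ℝ)) b) := by
      rw [inChart_smul]
      change ((ρ j ((chartAt E j).symm y)) • (d η ((chartAt E j).symm y)).compContinuousLinearMap
          ((chartSymmDeriv j y).restrictScalars ℝ)) b = _
      rw [hd]
      exact (Complex.coe_smul _ _).symm
    rw [h1, top_form_comp b, det_restrictScalars_complex, ContinuousAlternatingMap.smul_apply]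
    simp only [g, D, smul_eq_mul]
    push_cast
    ring
  -- No continuity of `a` is available, as the identification of tangent spaces with `E` may jump.
  -- Regularity of `g` is read off from the smooth form instead.
  have hgeq : ∀ j y, g j y = (inChart j (τ j) y b / ν b).re := fun j y => by
    rw [hτg, mul_div_cancel_right₀ _ hνb, Complex.ofReal_re]
  have hgc : ∀ j, ContinuousOn (g j) (chartAt E j).target := by
    intro j
    have h1 : ContinuousOn (fun y => inChart j (τ j) y b) (chartAt E j).target :=
      (ContinuousAlternatingMap.apply ℝ E ℂ b).continuous.comp_continuousOn (hτ j j).continuousOn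
    refine (Complex.continuous_re.comp_continuousOn (h1.div_const (ν b))).congr fun y _ => hgeq j y
  have hτi : ∀ j, IntegrableOn (fun y => inChart j (τ j) y b) (chartAt E j).target μ := fun j =>
    integrableOn_inChart μ b (hτ j) (hcpt j) (hsupp j) fun x hx => by
      simp only [τ, image_eq_zero_of_notMem_tsupport hx, form_zero_smul]
  have hgi : ∀ j, IntegrableOn (g j) (chartAt E j).target μ := by
    intro j
    have h1 := ((hτi j).div_const (ν b)).re
    refine h1.congr (Filter.Eventually.of_forall fun y => (hgeq j y).symm)
  have hsum0 : ∑ j ∈ S, ∫ y in (chartAt E j).target, g j y ∂μ = 0 := by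
    have h := sum_chartIntegral_d_eq_zero μ b hη hsum hsupp hsmooth
    have h1 : ∀ j, chartIntegral μ b j (fun x => ρ j x • d η x) =
        ((∫ y in (chartAt E j).target, g j y ∂μ : ℝ) : ℂ) * ν b := by
      intro j
      rw [← integral_complex_ofReal, ← integral_mul_const]
      exact integral_congr_ae (Filter.Eventually.of_forall fun y => hτg j y)
    simp only [h1] at h
    rw [← Finset.sum_mul, ← Complex.ofReal_sum] at h
    exact_mod_cast (mul_eq_zero.mp h).resolve_right hνb
  -- Nonnegative integrals with zero sum all vanish; a continuous nonnegative function with zero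
  -- integral over an open set is zero there.
  have hzero : ∀ j ∈ S, ∀ y ∈ (chartAt E j).target, inChart j (τ j) y = 0 := by
    intro j hj y hy
    have h1 := (Finset.sum_eq_zero_iff_of_nonneg
      (fun i _ => integral_nonneg fun y => hg0 i y)).mp hsum0 j hj
    have h2 := (setIntegral_eq_zero_iff_of_nonneg_ae
      (Filter.Eventually.of_forall fun y => hg0 j y) (hgi j)).mp h1
    have h3 := Measure.eqOn_open_of_ae_eq h2 (chartAt E j).open_target (hgc j)
      continuousOn_const hy
    have h4 : g j y = 0 := h3
    ext v
    rw [top_form_apply b, hτg, h4, Complex.ofReal_zero, zero_mul, mul_zero]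
    rfl
  funext x
  have hx : d η x = ∑ j ∈ S, τ j x := by
    simp only [τ]
    rw [← Finset.sum_smul, hsum, one_smul]
  rw [hx]
  refine Finset.sum_eq_zero fun j hj => ?_
  by_cases hxj : x ∈ (chartAt E j).source
  · have hxx : (chartAt E x).symm (chartAt E x x) = x :=
      (chartAt E x).left_inv (mem_chart_source E x)
    rw [← fromChart_inChart x (τ j), inChart_eq_transition (x₁ := j) (τ j) (mem_chart_target E x)
      (by rwa [hxx]), hzero j hj]
    · rfl
    · simpa [transition, hxx] using (chartAt E j).map_source hxj
  · have : ρ j x = 0 := image_eq_zero_of_notMem_tsupport fun h => hxj (hsupp j h)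
    simp only [τ, this, form_zero_smul]

end Stokes

/-! ### From exactness of `Ω` to vanishing of `ξ`. -/

section Exactness

variable {E : Type*} [NormedAddCommGroup E] [NormedSpace ℂ E]

theorem castDeg_castDeg {r s t : ℕ} (h : r = s) (h' : s = t) (α : E [⋀^Fin r]→L[ℝ] ℂ) :
    castDeg h' (castDeg h α) = castDeg (h.trans h') α := by
  subst h h'
  rfl

theorem castDeg_add {r s : ℕ} (h : r = s) (α β : E [⋀^Fin r]→L[ℝ] ℂ) :
    castDeg h (α + β) = castDeg h α + castDeg h β := rfl

theorem castDeg_smul {r s : ℕ} (h : r = s) (c : ℂ) (α : E [⋀^Fin r]→L[ℝ] ℂ) :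
    castDeg h (c • α) = c • castDeg h α := rfl

theorem castDeg_ne_zero {r s : ℕ} (h : r = s) {α : E [⋀^Fin r]→L[ℝ] ℂ} (hα : α ≠ 0) :
    castDeg h α ≠ 0 := by
  subst h
  exact hα

theorem IsSimple.hasWeight {k : ℕ} {β : E [⋀^Fin k]→L[ℝ] ℂ} (h : IsSimple β) :
    HasWeight (Complex.I ^ k) β := by
  obtain ⟨f, rfl⟩ := h
  exact hasWeight_wedgeFun f

theorem I_mul_neg_I : Complex.I * -Complex.I = 1 := by simp

theorem hasWeight_of_bidegree_self {a : ℕ} {α : E [⋀^Fin (a + a)]→L[ℝ] ℂ}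
    (h : α ∈ bidegree E a a) : HasWeight 1 α := by
  have := hasWeight_of_mem_bidegree h
  rwa [← mul_pow, I_mul_neg_I, one_pow] at this

theorem hasWeight_of_bidegree_succ_right {a q : ℕ} (hq : a + 1 = q)
    {α : E [⋀^Fin (a + q)]→L[ℝ] ℂ} (h : α ∈ bidegree E a q) : HasWeight (-Complex.I) α := by
  subst hq
  have := hasWeight_of_mem_bidegree h
  rwa [pow_succ, ← mul_assoc, ← mul_pow, I_mul_neg_I, one_pow, one_mul] at this

theorem hasWeight_of_bidegree_succ_left {a q : ℕ} (hq : a + 1 = q)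
    {α : E [⋀^Fin (q + a)]→L[ℝ] ℂ} (h : α ∈ bidegree E q a) : HasWeight Complex.I α := by
  subst hq
  have := hasWeight_of_mem_bidegree h
  rwa [pow_succ, mul_right_comm, ← mul_pow, I_mul_neg_I, one_pow, one_mul] at this

/-- The product of a form of weight `-1` with `ξ ∧ \bar ξ`, for `ξ` simple, vanishes in top
degree. -/
theorem wedge_wedge_conj_eq_zero [FiniteDimensional ℂ E] {r k : ℕ} {α : E [⋀^Fin r]→L[ℝ] ℂ}
    (hα : HasWeight (-1) α) {ξ : E [⋀^Fin k]→L[ℝ] ℂ} (hξ : IsSimple ξ)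
    (hdim : Module.finrank ℝ E = r + k + k) : wedge (wedge α ξ) (conj ξ) = 0 := by
  refine ((hα.wedge hξ.hasWeight).wedge hξ.hasWeight.conj).eq_zero_of_top hdim ?_
  rw [map_pow, Complex.conj_I, mul_assoc, ← mul_pow, I_mul_neg_I, one_pow]
  norm_num

variable {M : Type*} [TopologicalSpace M] [ChartedSpace E M]

theorem inChart_zero {r : ℕ} (x₀ : M) : inChart x₀ (0 : Form E M r) = fun _ => 0 :=
  funext fun _ => inChart_eq_zero rfl

theorem del_zero {r : ℕ} : del (0 : Form E M r) = 0 := by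
  funext x
  rw [del, inChart_zero, fderiv_fun_const]
  ext v
  simp [fromChart, linearPart, ContinuousAlternatingMap.alternatizeUncurryFin_apply]

theorem delbar_zero {r : ℕ} : delbar (0 : Form E M r) = 0 := by
  have h := d_eq_del_add_delbar (0 : Form E M r)
  rw [d_zero, del_zero, zero_add] at h
  exact h.symm

variable [FiniteDimensional ℂ E] [IsManifold 𝓘(ℂ, E) ω M] [CompactSpace M] [T2Space M]

/-- Exactness is demanded only after wedging with `ξ ∧ \bar ξ`, so that the same argument covers the
de Rham case and the cases where `Ω` itself is not shown to be exact. -/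
theorem eq_zero_of_wedge_exact {p k s : ℕ} (hk : Module.finrank ℂ E - p = k)
    (hp : p ≤ Module.finrank ℂ E) {Ω : Form E M (p + p)} (hΩ : ∀ x, IsTransverse (Ω x))
    {ξ : Form E M k} (hξ : IsSmooth ξ) (hdξ : d ξ = 0) (hsimple : ∀ x, IsSimple (ξ x))
    (hs : s + 1 = p + p) {η : Form E M s} (hη : IsSmooth η)
    (hexact : ∀ x, wedge (wedge (Ω x) (ξ x)) (conj (ξ x)) =
      wedge (wedge (castDeg hs (d η x)) (ξ x)) (conj (ξ x))) : ξ = 0 := by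
  have hT : ∀ x, ∀ β : E [⋀^Fin k]→L[ℝ] ℂ, IsSimple β → β ≠ 0 →
      StrictlyPositive (sigma k • wedge (wedge (Ω x) β) (conj β)) := by
    subst hk
    exact hΩ
  have hdeg : p + p + k + k = Module.finrank ℂ E + Module.finrank ℂ E := by omega
  have hdeg' : Module.finrank ℂ E + Module.finrank ℂ E = s + k + k + 1 := by omega
  have hdim : Module.finrank ℝ E = s + k + k + 1 := by
    rw [finrank_real_of_complex]
    omega
  have hηξ : IsSmooth fun x => wedge (η x) (ξ x) := hη.wedge hξ
  let ζ : Form E M (s + k + k) := fun x => wedge (wedge (η x) (ξ x)) (conj (ξ x))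
  have hζ : IsSmooth ζ := hηξ.wedge hξ.conj
  have hdconj : d (fun x => conj (ξ x)) = 0 := by
    rw [d_conj ξ hξ, hdξ]
    funext x
    ext v
    exact map_zero (starRingEnd ℂ)
  have hdζ : ∀ x, castDeg (hdeg.trans hdeg') (wedge (wedge (Ω x) (ξ x)) (conj (ξ x))) =
      d ζ x := by
    intro x
    rw [hexact, d_wedge_of_closed hηξ hξ.conj hdconj, d_wedge_of_closed hη hξ hdξ]
    simp only [wedge_castDeg_left, castDeg_castDeg]
  -- The constant `σ_k` from transversality is absorbed here, so that `dζ` is a nonnegative real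
  -- multiple of one fixed form.
  let ν : E [⋀^Fin (s + k + k + 1)]→L[ℝ] ℂ := (sigma k)⁻¹ • castDeg hdeg' (refVol E)
  have hν : ν ≠ 0 := fun h => castDeg_ne_zero hdeg' (refVol_ne_zero E)
    (form_eq_zero_of_smul (inv_ne_zero (sigma_ne_zero k)) h)
  have hpos : ∀ x, ∃ a : ℝ, 0 ≤ a ∧ (ξ x ≠ 0 → 0 < a) ∧ d ζ x = (a : ℂ) • ν := by
    intro x
    by_cases hx : ξ x = 0
    · refine ⟨0, le_rfl, fun h => absurd hx h, ?_⟩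
      rw [← hdζ, hx, wedge_zero_right, wedge_zero_left]
      ext v
      change (0 : ℂ) = ((0 : ℝ) : ℂ) * ν v
      simp
    · obtain ⟨a, ha, h⟩ := (hT x (ξ x) (hsimple x) hx).exists_refVol hdeg
      refine ⟨a, ha.le, fun _ => ha, ?_⟩
      rw [castDeg_smul] at h
      rw [← hdζ, ← castDeg_castDeg hdeg hdeg']
      ext v
      have hv := DFunLike.congr_fun (congrArg (castDeg hdeg') h) v
      change sigma k * _ = (a : ℂ) * _ at hv
      change _ = (a : ℂ) * ((sigma k)⁻¹ * castDeg hdeg' (refVol E) v)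
      rw [mul_left_comm, eq_inv_mul_iff_mul_eq₀ (sigma_ne_zero k)]
      exact hv
  choose a ha0 hapos had using hpos
  have hzero := d_eq_zero_of_nonneg hζ hdim hν ha0 had
  funext x
  by_contra hx
  have h1 := had x
  rw [hzero] at h1
  exact hν (form_eq_zero_of_smul (Complex.ofReal_ne_zero.mpr (hapos x hx).ne') h1.symm)

/-- The primitive is `λ + μ`; its error terms `\bar∂λ` and `∂μ` have weights `(-i)(-i)` and `i·i`,
both `-1`, so they disappear against `ξ ∧ \bar ξ`. Assuming weights rather than bidegrees lets
either form be zero. -/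
theorem eq_zero_of_del_add_delbar {p k s t : ℕ} (hk : Module.finrank ℂ E - p = k)
    (hp : p ≤ Module.finrank ℂ E) {Ω : Form E M (p + p)} (hΩ : ∀ x, IsTransverse (Ω x))
    {ξ : Form E M k} (hξ : IsSmooth ξ) (hdξ : d ξ = 0) (hsimple : ∀ x, IsSimple (ξ x))
    (hs : s + 1 = p + p) (ht : t + 1 = p + p) {lam : Form E M s} {mu : Form E M t}
    (hlam : IsSmooth lam) (hmu : IsSmooth mu) (hlamw : ∀ x, HasWeight (-Complex.I) (lam x))
    (hmuw : ∀ x, HasWeight Complex.I (mu x))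
    (hexact : ∀ x, Ω x = castDeg hs (del lam x) + castDeg ht (delbar mu x)) : ξ = 0 := by
  obtain rfl : s = t := by omega
  refine eq_zero_of_wedge_exact hk hp hΩ hξ hdξ hsimple hs (hlam.add hmu) fun x => ?_
  have hw1 : HasWeight (-1) (delbar lam x) := by
    have := hasWeight_delbar hlam hlamw x
    rwa [neg_mul_neg, Complex.I_mul_I] at this
  have hw2 : HasWeight (-1) (del mu x) := by
    have := hasWeight_del hmu hmuw x
    rwa [Complex.I_mul_I] at this
  have hrest : wedge (wedge (castDeg hs (delbar lam x + del mu x)) (ξ x)) (conj (ξ x)) = 0 := by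
    refine wedge_wedge_conj_eq_zero ((hw1.add hw2).castDeg hs) (hsimple x) ?_
    rw [finrank_real_of_complex]
    omega
  have hd : d (lam + mu) x = (del lam x + delbar mu x) + (delbar lam x + del mu x) := by
    rw [d_add hlam hmu, d_eq_del_add_delbar, d_eq_del_add_delbar]
    simp only [Pi.add_apply]
    abel
  rw [hd, castDeg_add hs (del lam x + delbar mu x), wedge_add_left, wedge_add_left, hrest,
    add_zero, hexact, castDeg_add]

end Exactness

end PKahler

end

/-! ### The theorem, by cases on the cohomology. -/

open PKahler in
theorem mainTheorem5
    {E : Type*} [NormedAddCommGroup E] [NormedSpace ℂ E] [FiniteDimensional ℂ E]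
    {M : Type*} [TopologicalSpace M] [ChartedSpace E M] [IsManifold 𝓘(ℂ, E) ω M]
    [CompactSpace M] [T2Space M]
    (n p : ℕ) (hn : Module.finrank ℂ E = n) (hp : 1 < p) (hpn : p ≤ n - 1)
    (Ω : Form E M (p + p)) (hΩ : IsPKahler p Ω)
    (hvanish : DeRhamClassVanishes Ω ∨ AeppliClassVanishes p p Ω ∨
      BottChernClassVanishes p p Ω ∨ DelClassVanishes p p Ω ∨ DelbarClassVanishes p p Ω) :
    ¬ ∃ ξ : Form E M (n - p), IsSmoothOfBidegree (n - p) 0 ξ ∧ (∀ x, IsSimple (ξ x)) ∧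
      (∃ x, ξ x ≠ 0) ∧ del ξ = 0 ∧ delbar ξ = 0 := by
  rintro ⟨ξ, ⟨hξ, -⟩, hsimple, ⟨x₀, hx₀⟩, hdel, hdelbar⟩
  subst hn
  -- The degree `(n - p) + 0` coming from the bidegree is definitionally `n - p`.
  have hξs : IsSmooth (r := Module.finrank ℂ E - p) ξ := hξ
  have hdξ : d ξ = 0 := by rw [d_eq_del_add_delbar, hdel, hdelbar, add_zero]
  have hpE : p ≤ Module.finrank ℂ E := by omega
  suffices h : ξ = 0 from hx₀ (congrFun h x₀)
  have hT := hΩ.transverse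
  rcases hvanish with ⟨s, hs, η, hη, h⟩ | ⟨a, b, ha, hb, lam, mu, hlam, hmu, h⟩ |
    ⟨a, b, ha, hb, η, hη, h⟩ | ⟨a, ha, lam, hlam, h⟩ | ⟨b, hb, mu, hmu, h⟩
  · exact eq_zero_of_wedge_exact rfl hpE hT hξs hdξ hsimple hs hη fun x => by rw [h]
  · exact eq_zero_of_del_add_delbar rfl hpE hT hξs hdξ hsimple (by omega) (by omega) hlam.1 hmu.1
      (fun x => hasWeight_of_bidegree_succ_right ha (hlam.2 x))
      (fun x => hasWeight_of_bidegree_succ_left hb (hmu.2 x)) h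
  · obtain rfl : a = b := by omega
    have hw : ∀ x, HasWeight 1 (η x) := fun x => hasWeight_of_bidegree_self (hη.2 x)
    -- Bott–Chern is the case `λ = \bar∂η`, `μ = 0`; `η` has weight `1`, so `λ` is smooth and has
    -- weight `-i`.
    refine eq_zero_of_del_add_delbar (t := a + a + 1) (mu := 0) rfl hpE hT hξs hdξ hsimple
      (by omega) (by omega) (hη.1.delbar hw) isSmooth_zero (fun x => ?_)
      (fun x => hasWeight_zero _) fun x => ?_
    · simpa using hasWeight_delbar hη.1 hw x
    · rw [h, delbar_zero]
      exact (add_zero _).symm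
  · refine eq_zero_of_del_add_delbar (t := a + p) (mu := 0) rfl hpE hT hξs hdξ hsimple
      (by omega) (by omega) hlam.1 isSmooth_zero
      (fun x => hasWeight_of_bidegree_succ_right ha (hlam.2 x))
      (fun x => hasWeight_zero _) fun x => ?_
    rw [h, delbar_zero]
    exact (add_zero _).symm
  · refine eq_zero_of_del_add_delbar (s := p + b) (lam := 0) rfl hpE hT hξs hdξ hsimple
      (by omega) (by omega) isSmooth_zero hmu.1 (fun x => hasWeight_zero _)
      (fun x => hasWeight_of_bidegree_succ_left hb (hmu.2 x)) fun x => ?_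
    rw [h, del_zero]
    exact (zero_add _).symm
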